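/- Setting. Let $E$ be the set of $1$-Lipschitz functions $f:\mathbb R\to\mathbb R$ with $f_{\alpha+\pi}+f_\alpha=\pi$ for all $\alpha$, with the supremum norm $\|\cdot\|_\infty$; this is the injective hull of the circle of length $2\pi$. Inside $E$, the circle $S^1$ consists of the functions $\alpha\mapsto\arccos(\cos(\alpha-\tau))$, $\tau\in\mathbb R$, and the hemisphere $S^2_+$ of the functions $\alpha\mapsto\arccos(\cos d\,\cos(\alpha-\tau))$, $d\in[0,\frac\pi2]$, $\tau\in\mathbb R$. For $r\in(0,\frac\pi2)$ let $E_r=\{f\in E: r\le f_\alpha\le\pi-r\text{ for all }\alpha\}=\{f\in E:\operatorname{dist}(f,S^1)\ge r\}$. For $f\in E\setminus S^1$ and $\alpha\ne\beta$ mod $\pi$ put \[p_{\alpha,\beta}(f)=\frac{1-\cos^2(\beta-\alpha)-\cos^2 f_\alpha-\cos^2 f_\beta+2\cos(\beta-\alpha)\cos f_\alpha\cos f_\beta}{\sin^2(\beta-\alpha)\,\sin^2 f_\alpha\,\sin^2 f_\beta},\] and let $E^+$ be the set of $f\in E\setminus S^1$ with $p_{\alpha,\beta}(f)>0$ for all $\alpha\neq\beta$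 mod $\pi$. For $v,w\in L^\infty([0,\pi))$ let $\omega_f(v\wedge w)=\int_0^\pi\int_\alpha^\pi p_{\alpha,\beta}(f)(v_\alpha w_\beta-v_\beta w_\alpha)\,d\beta\,d\alpha$. Let $\|\omega_f\|_{\rm ir}$ be the infimum of all $M\ge0$ with $|\omega_f(v\wedge w)|\le M\mu^{\rm ir}(v\wedge w)$ for all $v,w\in L^\infty([0,\pi))$, where $\mu^{\rm ir}(v\wedge w)$ is $0$ if $v,w$ are linearly dependent, and otherwise is the measure of the parallelogram spanned by $v,w$ with respect to the Haar measure on $V=\operatorname{span}\{v,w\}$ that gives measure $\pi$ to the ellipse of maximal area contained in the unit ball of $V$. Let $L^2_0$ be the space of (classes of) $\pi$-periodic functions $\eta\in L^2_{\rm loc}(\mathbb R)$ with $\int_0^\pi\eta=0$, with $\|\eta\|_2^2=\pi\int_0^\pi\eta^2$, and let $B_\varepsilon=\{\eta\in L^2_0:\|\eta\|_\infty\le\varepsilon\}$. For $h\in S^2_+\setminus S^1$ let $\nu_h(\alpha)=\int_0^\alpha\frac{\sin(\operatorname{dist}(h,S^1))}{\sin(h_t)^2}\,dt$ and \[\Psi_h(f,\eta)=\int_0^\pi\int_\alpha^\pi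 p_{\alpha,\beta}(f)\,\sin\bigl(\nu_h(\beta)-\nu_h(\alpha)+\eta(\beta)-\eta(\alpha)\bigr)\,d\beta\,d\alpha .\] Proposition. For every $\xi\in(0,1)$ and $r\in(0,\frac\pi2)$ there exist $\varepsilon_1\in(0,\frac r2)$, $\varepsilon_2>0$ and $c,C>0$ such that for all $h\in S^2_+\cap E_r$ and all $f\in E^+$ with $\|f-h\|_\infty\le\varepsilon_1$ the following hold. (1) The function $\eta\mapsto\Psi_h(f,\eta)$ is strictly concave on $B_{\varepsilon_2}$. For all $\eta^0,\eta^1\in B_{\varepsilon_2}$ and $\eta^t=(1-t)\eta^0+t\eta^1$, the function $t\mapsto\Psi_h(f,\eta^t)$ is $C^2$ and \[\frac{d^2}{dt^2}\Psi_h(f,\eta^t)\le-c\,\|\eta^1-\eta^0\|_2^2\qquad\text{for all }t\in[0,1].\] There is a unique maximizer $\eta_f$ of $\Psi_h(f,\cdot)$ in $B_{\varepsilon_2}$, and it satisfies $\Psi_h(f,\eta_f)=\sup_{\eta\in L^2_0}\Psi_h(f,\eta)=\|\omega_f\|_{\rm ir}$. (2) $\|\eta_f\|_\infty\le C\,\|f-h\|_\infty^{\xi}$.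 -/

import Mathlib

open Real Set MeasureTheory
open scoped BoundedContinuousFunction ENNReal

noncomputable section

namespace CircleHull

/-- The injective hull `E(S¹)` of the circle of length `2π`: the `1`-Lipschitz functions
`f : ℝ → ℝ` with `f (α + π) + f α = π`, with the supremum metric. Such functions are automatically
bounded, so they are collected as a subset of the bounded continuous functions. -/
def hull : Set (ℝ →ᵇ ℝ) :=
  {f | LipschitzWith 1 f ∧ ∀ α : ℝ, f (α + π) + f α = π}

/-- The circle `S¹` inside its injective hull. -/
def circle : Set (ℝ →ᵇ ℝ) :=
  {f | ∃ τ : ℝ, ∀ α : ℝ, f α = arccos (cos (α - τ))}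

/-- The hemisphere `S²₊` inside the injective hull. -/
def hemisphere : Set (ℝ →ᵇ ℝ) :=
  {f | ∃ d ∈ Icc (0 : ℝ) (π / 2), ∃ τ : ℝ, ∀ α : ℝ, f α = arccos (cos d * cos (α - τ))}

/-- The truncated hull `E_r(S¹)`. -/
def truncatedHull (r : ℝ) : Set (ℝ →ᵇ ℝ) :=
  {f | f ∈ hull ∧ ∀ α : ℝ, f α ∈ Icc r (π - r)}

/-- The coefficient `p_{α,β}(f)`. -/
def coeff (f : ℝ → ℝ) (α β : ℝ) : ℝ :=
  (1 - cos (β - α) ^ 2 - cos (f α) ^ 2 - cos (f β) ^ 2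
      + 2 * cos (β - α) * cos (f α) * cos (f β))
    / (sin (β - α) ^ 2 * sin (f α) ^ 2 * sin (f β) ^ 2)

/-- The set `E⁺(S¹)`: all `f` in the hull, off the circle, such that `p_{α,β}(f) > 0` whenever
`α` and `β` differ modulo `π`. -/
def hullPos : Set (ℝ →ᵇ ℝ) :=
  {f | f ∈ hull ∧ f ∉ circle ∧
    ∀ α β : ℝ, (∀ k : ℤ, β - α ≠ k * π) → 0 < coeff f α β}

/-- An ellipse in the plane: an image of the closed unit disc under an invertible affine map. -/
def IsEllipse (A : Set (EuclideanSpace ℝ (Fin 2))) : Prop :=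
  ∃ (L : EuclideanSpace ℝ (Fin 2) ≃ₗ[ℝ] EuclideanSpace ℝ (Fin 2))
    (c : EuclideanSpace ℝ (Fin 2)),
    A = (fun x => L x + c) '' Metric.closedBall 0 1

/-- The unit ball of the plane spanned by `v` and `w`, in the coordinates given by `v, w`. -/
def planeBall {V : Type*} [NormedAddCommGroup V] [NormedSpace ℝ V] (v w : V) :
    Set (EuclideanSpace ℝ (Fin 2)) :=
  {x | ‖x 0 • v + x 1 • w‖ ≤ 1}

open Classical in
/-- The inscribed (inner) Riemannian area `μ^ir(v ∧ w)` of the parallelogram spanned by `v` and `w`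
in a normed space. If `v, w` are independent this is the measure of the parallelogram for the Haar
measure on `span {v, w}` giving measure `π` to the ellipse of largest area inside the
unit ball. In the coordinates `v, w` the parallelogram is the unit square, and this Haar measure is
Lebesgue measure times `π / (largest Lebesgue area of an inscribed ellipse)`. -/
def innerRiemannianArea {V : Type*} [NormedAddCommGroup V] [NormedSpace ℝ V] (v w : V) : ℝ :=
  if LinearIndependent ℝ ![v, w] then
    π / sSup {a : ℝ | ∃ A, IsEllipse A ∧ A ⊆ planeBall v w ∧ a = volume.real A}
  else 0

/-- The Banach space `L^∞([0,π))`. -/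
abbrev LInf : Type := Lp ℝ ∞ (volume.restrict (Ico (0 : ℝ) π))

/-- The value `ω_f(v ∧ w)` of the two-form `ω` at `f`. -/
def form (f : ℝ → ℝ) (v w : LInf) : ℝ :=
  ∫ α in (0 : ℝ)..π, ∫ β in α..π, coeff f α β * (v α * w β - v β * w α)

/-- The inner Riemannian comass `‖ω_f‖_ir`. -/
def comass (f : ℝ → ℝ) : ℝ :=
  sInf {M : ℝ | 0 ≤ M ∧ ∀ v w : LInf, |form f v w| ≤ M * innerRiemannianArea v w}

/-- The function `ν_h` with `ν_h(0) = 0` and `ν_h'(α) = sin (dist (h, S¹)) / sin (h α) ^ 2`. -/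
def nu (h : ℝ →ᵇ ℝ) (α : ℝ) : ℝ :=
  ∫ t in (0 : ℝ)..α, sin (Metric.infDist h circle) / sin (h t) ^ 2

/-- The space `L²₀(ℝ)` of (classes of) `π`-periodic, locally square integrable functions with
vanishing mean over a period. -/
def L2Zero : Set (ℝ →ₘ[volume] ℝ) :=
  {η | (∀ᵐ x : ℝ, η (x + π) = η x) ∧
    (∀ K : Set ℝ, IsCompact K → MemLp η 2 (volume.restrict K)) ∧
    ∫ x in (0 : ℝ)..π, η x = 0}

/-- The square of the norm of `L²₀(ℝ)`, induced by the scalar product `π ∫₀^π η₁ η₂`. -/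
def normSqL2 (η : ℝ →ₘ[volume] ℝ) : ℝ :=
  π * ∫ x in (0 : ℝ)..π, η x ^ 2

/-- The intersection of `L²₀(ℝ)` with the closed ball of radius `ε` around `0` in `L^∞(ℝ)`. -/
def smallBall (ε : ℝ) : Set (ℝ →ₘ[volume] ℝ) :=
  {η | η ∈ L2Zero ∧ eLpNorm η ∞ volume ≤ ENNReal.ofReal ε}

/-- The functional `Ψ_h(f, η)`. -/
def Psi (h f : ℝ →ᵇ ℝ) (η : ℝ →ₘ[volume] ℝ) : ℝ :=
  ∫ α in (0 : ℝ)..π, ∫ β in α..π,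
    coeff f α β * sin ((nu h β - nu h α) + (η β - η α))

end CircleHull

end

/-!
The functional `Psi h f` and the two-form `form f` are governed by the same antisymmetric kernel
`orient α β * coeff f α β` on the square of one period, and everything reduces to comparing
`coeff f` with `coeff h`.

For `h` in the hemisphere the coefficient factorizes, `coeff h α β = ν'(α) ν'(β)` with `ν = nu h`
(`coeff_of_hemisphere`), and `ν` is a lift of a diffeomorphism of `ℝ / π ℤ` (`isAngle_nu`). In the
coordinate `ν` the kernel at `h` is constant and all quadratic forms are convolutions. For `f` in
the hull near `h`, half-angle formulas show
`|coeff f α β - coeff h α β| ≤ C (‖f - h‖ / |sin (β - α)|) ^ ξ` (`abs_coeff_sub_le_rpow`), so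
that the two kernels differ by `O(‖f - h‖ ^ ξ)` in `L¹`, uniformly in one variable
(`isKernel_coeff`). By the Schur test every estimate that holds with room to spare at `h` persists
at `f`.

Three estimates are needed.
* The second variation `∬ |sin Δν| (ζ β - ζ α) ^ 2` is coercive on functions of mean zero
  (`IsKernel.coercive`); this gives strict concavity and the bound on the second derivative.
* The Euler–Lagrange equation is solved in the bounded continuous periodic functions by a
  simplified Newton iteration. Its linearization at `h` is the averaging operator with kernel
  `|sin Δν| / 2`, a contraction on functions of weighted mean zero for the supremum norm
  (`IsKernel.exists_gradient_eq_zero`). The solution is bounded by the size `O(‖f - h‖ ^ ξ)` of the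
  gradient at `0`.
* A small solution of the Euler–Lagrange equation with phase `φ = ν + η` maximizes the two-form
  among *all* pairs with `v ^ 2 + w ^ 2 ≤ 1` (`IsKernel.form_le_of_critical`): writing
  `v + i w = e ^ {i φ} u` and `λ α = ∫ orient * coeff f * sin Δφ dβ`, the form
  `∫ λ |u| ^ 2 - 2 form f v w` is invariant under adding constants to `u`, and it is
  nonnegative on functions `u` of weighted mean zero.

Finally the inner Riemannian comass is the maximum of the two-form on the pairs with
`v ^ 2 + w ^ 2 ≤ 1` (`comass_eq`), because these are the pairs for which the unit disc lies in the
unit ball of the plane they span. So the small critical point is at once the maximizer in the small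
ball, the maximizer over `L²₀` and a calibrating phase for the comass.
-/

noncomputable section

namespace CircleHull

/-! ### Bounded measurable functions -/

/-- Bounded measurable real functions. All integrands below are of this kind and all measures are
finite, so that integrability follows from the closure properties of this class. -/
@[fun_prop]
structure BddMeas {X : Type*} [MeasurableSpace X] (f : X → ℝ) : Prop where
  measurable : Measurable f
  bounded : ∃ C, ∀ x, |f x| ≤ C

namespace BddMeas

variable {X Y : Type*} [MeasurableSpace X] [MeasurableSpace Y] {f g : X → ℝ}

@[fun_prop]
theorem const (c : ℝ) : BddMeas (fun _ : X => c) := ⟨measurable_const, |c|, fun _ => le_rfl⟩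

@[fun_prop]
theorem add (hf : BddMeas f) (hg : BddMeas g) : BddMeas (fun x => f x + g x) := by
  obtain ⟨C, hC⟩ := hf.bounded
  obtain ⟨D, hD⟩ := hg.bounded
  exact ⟨hf.measurable.add hg.measurable, C + D, fun x =>
    (abs_add_le _ _).trans (add_le_add (hC x) (hD x))⟩

@[fun_prop]
theorem sub (hf : BddMeas f) (hg : BddMeas g) : BddMeas (fun x => f x - g x) := by
  obtain ⟨C, hC⟩ := hf.bounded
  obtain ⟨D, hD⟩ := hg.bounded
  exact ⟨hf.measurable.sub hg.measurable, C + D, fun x =>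
    (abs_sub _ _).trans (add_le_add (hC x) (hD x))⟩

@[fun_prop]
theorem mul (hf : BddMeas f) (hg : BddMeas g) : BddMeas (fun x => f x * g x) := by
  obtain ⟨C, hC⟩ := hf.bounded
  obtain ⟨D, hD⟩ := hg.bounded
  refine ⟨hf.measurable.mul hg.measurable, C * D, fun x => ?_⟩
  rw [abs_mul]
  exact mul_le_mul (hC x) (hD x) (abs_nonneg _) ((abs_nonneg _).trans (hC x))

@[fun_prop]
theorem pow (hf : BddMeas f) (n : ℕ) : BddMeas (fun x => f x ^ n) := by
  obtain ⟨C, hC⟩ := hf.bounded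
  refine ⟨hf.measurable.pow_const n, C ^ n, fun x => ?_⟩
  rw [abs_pow]
  exact pow_le_pow_left₀ (abs_nonneg _) (hC x) n

@[fun_prop]
theorem div_const (hf : BddMeas f) (c : ℝ) : BddMeas (fun x => f x / c) := by
  simpa only [div_eq_mul_inv] using hf.mul (const c⁻¹)

@[fun_prop]
theorem abs (hf : BddMeas f) : BddMeas (fun x => |f x|) := by
  obtain ⟨C, hC⟩ := hf.bounded
  exact ⟨hf.measurable.abs, C, fun x => by simpa using hC x⟩

@[fun_prop]
theorem comp {φ : Y → X} (hf : BddMeas f) (hφ : Measurable φ) : BddMeas (fun y => f (φ y)) := by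
  obtain ⟨C, hC⟩ := hf.bounded
  exact ⟨hf.measurable.comp hφ, C, fun x => hC _⟩

theorem integrable (hf : BddMeas f) (μ : Measure X) [IsFiniteMeasure μ] : Integrable f μ := by
  obtain ⟨C, hC⟩ := hf.bounded
  exact Integrable.of_bound hf.measurable.aestronglyMeasurable C (ae_of_all _ hC)

@[fun_prop]
theorem sin (hf : Measurable f) : BddMeas (fun x => Real.sin (f x)) :=
  ⟨by fun_prop, 1, fun x => abs_sin_le_one _⟩

@[fun_prop]
theorem cos (hf : Measurable f) : BddMeas (fun x => Real.cos (f x)) :=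
  ⟨by fun_prop, 1, fun x => abs_cos_le_one _⟩

end BddMeas

/-- Lebesgue measure on one period. -/
def period : Measure ℝ := volume.restrict (Ioc 0 π)

instance : IsFiniteMeasure period := by unfold period; infer_instance

theorem intervalIntegral_eq_period (f : ℝ → ℝ) : ∫ x in (0 : ℝ)..π, f x = ∫ x, f x ∂period := by
  rw [intervalIntegral.integral_of_le pi_pos.le]; rfl

theorem integral_period_const (c : ℝ) : ∫ _, c ∂period = π * c := by
  rw [← intervalIntegral_eq_period]; simp

/-- Lebesgue measure on the square of one period. -/
abbrev period2 : Measure (ℝ × ℝ) := period.prod period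

theorem integral_period2 {F : ℝ × ℝ → ℝ} (hF : BddMeas F) :
    ∫ z, F z ∂period2 = ∫ α, ∫ β, F (α, β) ∂period ∂period :=
  integral_prod F (hF.integrable _)

theorem integral_period2_swap (F : ℝ × ℝ → ℝ) :
    ∫ z, F (z.2, z.1) ∂period2 = ∫ z, F z ∂period2 :=
  integral_prod_swap (μ := period) (ν := period) F

theorem integral_period2_mul (f g : ℝ → ℝ) :
    ∫ z, f z.1 * g z.2 ∂period2 = (∫ x, f x ∂period) * ∫ x, g x ∂period :=
  integral_prod_mul f g

theorem BddMeas.section {F : ℝ × ℝ → ℝ} (hF : BddMeas F) (α : ℝ) :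
    BddMeas (fun β => F (α, β)) :=
  hF.comp (by fun_prop)

theorem BddMeas.integral_right {F : ℝ × ℝ → ℝ} (hF : BddMeas F) :
    BddMeas (fun α => ∫ β, F (α, β) ∂period) := by
  obtain ⟨C, hC⟩ := hF.bounded
  refine ⟨(hF.measurable.stronglyMeasurable.integral_prod_right' (ν := period)).measurable,
    C * period.real univ, fun α => ?_⟩
  exact norm_integral_le_of_norm_le_const (f := fun β => F (α, β)) (ae_of_all _ fun β => hC (α, β))

/-- Integrals of a symmetric function over the triangle are half of those over the square. -/
theorem integral_triangle {F : ℝ × ℝ → ℝ} (hF : BddMeas F) (hs : ∀ α β, F (β, α) = F (α, β))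
    (hd : ∀ α, F (α, α) = 0) {G : ℝ → ℝ → ℝ}
    (hG : ∀ α β, 0 < α → α < β → β ≤ π → G α β = F (α, β)) :
    ∫ α in (0 : ℝ)..π, ∫ β in α..π, G α β = (∫ z, F z ∂period2) / 2 := by
  set U : Set (ℝ × ℝ) := {z | z.1 < z.2} with hU
  have hUm : MeasurableSet U := measurableSet_lt measurable_fst measurable_snd
  have h1 : ∫ α in (0 : ℝ)..π, ∫ β in α..π, G α β = ∫ z, U.indicator F z ∂period2 := by
    have hint : Integrable (U.indicator F) period2 := (hF.integrable _).indicator hUm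
    rw [integral_prod _ hint, intervalIntegral_eq_period]
    unfold period
    refine setIntegral_congr_fun measurableSet_Ioc fun α hα => ?_
    rw [intervalIntegral.integral_of_le hα.2]
    have : ∀ β, U.indicator F (α, β) = (Ioi α).indicator (fun β => F (α, β)) β := by
      intro β
      by_cases h : α < β <;> simp [hU, h, indicator]
    simp_rw [this]
    rw [setIntegral_indicator measurableSet_Ioi]
    have hset : Ioc 0 π ∩ Ioi α = Ioc α π := by
      ext β
      simp only [mem_inter_iff, mem_Ioc, mem_Ioi]
      exact ⟨fun h => ⟨h.2, h.1.2⟩, fun h => ⟨⟨hα.1.trans h.1, h.2⟩, h.1⟩⟩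
    rw [hset]
    exact setIntegral_congr_fun measurableSet_Ioc fun β hβ => hG α β hα.1 hβ.1 hβ.2
  have h2 : ∫ z, U.indicator F z ∂period2
      = ∫ z, {z : ℝ × ℝ | z.2 < z.1}.indicator F z ∂period2 := by
    rw [← integral_period2_swap]
    refine integral_congr_ae (ae_of_all _ fun z => ?_)
    by_cases h : z.2 < z.1 <;> simp [hU, h, indicator, hs]
  have hV : MeasurableSet {z : ℝ × ℝ | z.2 < z.1} :=
    measurableSet_lt measurable_snd measurable_fst
  have h3 : ∫ z, F z ∂period2 = ∫ z, U.indicator F z ∂period2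
      + ∫ z, {z : ℝ × ℝ | z.2 < z.1}.indicator F z ∂period2 := by
    rw [← integral_add ((hF.integrable _).indicator hUm) ((hF.integrable _).indicator hV)]
    refine integral_congr_ae (ae_of_all _ fun z => ?_)
    obtain ⟨α, β⟩ := z
    rcases lt_trichotomy α β with h | h | h
    · simp [hU, h, h.le, indicator]
    · subst h; simp [hd, indicator]
    · simp [hU, h, h.le, indicator]
  rw [h1, h3, ← h2]; ring

/-- Schur test for nonnegative functions of the first variable. -/
theorem integral_mul_fst_le {K : ℝ × ℝ → ℝ} (hK : BddMeas K) {A : ℝ}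
    (hA : ∀ α, ∫ β, K (α, β) ∂period ≤ A) {g : ℝ → ℝ} (hg : BddMeas g) (h0 : ∀ x, 0 ≤ g x) :
    ∫ z, K z * g z.1 ∂period2 ≤ A * ∫ x, g x ∂period := by
  rw [integral_period2 (by fun_prop), ← integral_const_mul]
  simp only [integral_mul_const]
  refine integral_mono ((hK.integral_right.mul hg).integrable _)
    (((BddMeas.const A).mul hg).integrable _) fun α => ?_
  exact mul_le_mul_of_nonneg_right (hA α) (h0 α)

/-- Schur test for nonnegative functions of the second variable. -/
theorem integral_mul_snd_le {K : ℝ × ℝ → ℝ} (hK : BddMeas K) (hs : ∀ α β, K (β, α) = K (α, β))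
    {A : ℝ} (hA : ∀ α, ∫ β, K (α, β) ∂period ≤ A) {g : ℝ → ℝ} (hg : BddMeas g)
    (h0 : ∀ x, 0 ≤ g x) :
    ∫ z, K z * g z.2 ∂period2 ≤ A * ∫ x, g x ∂period := by
  rw [← integral_period2_swap]
  simp only [hs]
  exact integral_mul_fst_le hK hA hg h0

/-! ### Angle functions -/

/-- The sign of `sin (β - α)`: it is `1` for `0 ≤ α < β < π`, antisymmetric, and changes sign under
`β ↦ β + π`. -/
def orient (α β : ℝ) : ℝ := sin (β - α) / |sin (β - α)|

theorem orient_swap (α β : ℝ) : orient β α = -orient α β := by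
  unfold orient
  rw [← neg_sub β α, sin_neg, abs_neg, neg_div]

theorem orient_self (α : ℝ) : orient α α = 0 := by simp [orient]

theorem orient_add_pi (α β : ℝ) : orient α (β + π) = -orient α β := by
  unfold orient
  rw [show β + π - α = (β - α) + π by ring, sin_add_pi, abs_neg, neg_div]

theorem orient_of_lt {α β : ℝ} (h : α < β) (h' : β < α + π) : orient α β = 1 := by
  have : 0 < sin (β - α) := sin_pos_of_pos_of_lt_pi (by linarith) (by linarith)
  rw [orient, abs_of_pos this, div_self this.ne']

theorem abs_orient_le (α β : ℝ) : |orient α β| ≤ 1 := by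
  unfold orient
  rw [abs_div, abs_abs]
  exact div_self_le_one _

@[fun_prop]
theorem bddMeas_orient : BddMeas (fun z : ℝ × ℝ => orient z.1 z.2) :=
  ⟨by unfold orient; fun_prop, 1, fun _ => abs_orient_le _ _⟩

/-- `ν` is a lift of a diffeomorphism of `ℝ / π ℤ` with derivative `ρ` between `m` and `M`. -/
structure IsAngle (ν ρ : ℝ → ℝ) (m M : ℝ) : Prop where
  pos : 0 < m
  hasDerivAt : ∀ t, HasDerivAt ν (ρ t) t
  continuous : Continuous ρ
  lower : ∀ t, m ≤ ρ t
  upper : ∀ t, ρ t ≤ M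
  add_pi : ∀ t, ν (t + π) = ν t + π
  periodic : Function.Periodic ρ π

namespace IsAngle

variable {ν ρ : ℝ → ℝ} {m M : ℝ}

theorem rho_pos (h : IsAngle ν ρ m M) (t : ℝ) : 0 < ρ t := h.pos.trans_le (h.lower t)

theorem nu_continuous (h : IsAngle ν ρ m M) : Continuous ν :=
  continuous_iff_continuousAt.2 fun t => (h.hasDerivAt t).continuousAt

theorem strictMono (h : IsAngle ν ρ m M) : StrictMono ν :=
  strictMono_of_deriv_pos fun t => by rw [(h.hasDerivAt t).deriv]; exact h.rho_pos t

theorem bddMeas_rho (h : IsAngle ν ρ m M) : BddMeas ρ :=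
  ⟨h.continuous.measurable, M, fun t => by rw [abs_of_pos (h.rho_pos t)]; exact h.upper t⟩

theorem sin_nu_pos (h : IsAngle ν ρ m M) {α β : ℝ} (h1 : α < β) (h2 : β < α + π) :
    0 < sin (ν β - ν α) := by
  have h3 := h.strictMono h1
  have h4 := h.strictMono h2
  rw [h.add_pi] at h4
  exact sin_pos_of_pos_of_lt_pi (by linarith) (by linarith)

theorem orient_mul_sin (h : IsAngle ν ρ m M) (α β : ℝ) :
    orient α β * sin (ν β - ν α) = |sin (ν β - ν α)| := by
  have hper : Function.Periodic
      (fun β => orient α β * sin (ν β - ν α) - |sin (ν β - ν α)|) π := by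
    intro β
    simp only
    rw [orient_add_pi, h.add_pi, show ν β + π - ν α = (ν β - ν α) + π by ring, sin_add_pi, abs_neg]
    ring
  obtain ⟨γ, hγ, he⟩ := hper.exists_mem_Ico pi_pos β α
  have : orient α γ * sin (ν γ - ν α) - |sin (ν γ - ν α)| = 0 := by
    rcases hγ.1.eq_or_lt with h0 | h0
    · subst h0; simp
    · rw [orient_of_lt h0 hγ.2, abs_of_pos (h.sin_nu_pos h0 hγ.2)]; ring
  linarith

theorem integral_periodic {g : ℝ → ℝ} (hg : Function.Periodic g π) (α : ℝ) :
    ∫ x, g x ∂period = ∫ x in α..(α + π), g x := by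
  rw [← intervalIntegral_eq_period]
  have := hg.intervalIntegral_add_eq 0 α
  rwa [zero_add] at this

theorem integral_rho (h : IsAngle ν ρ m M) : ∫ β, ρ β ∂period = π := by
  rw [integral_periodic h.periodic 0, intervalIntegral.integral_eq_sub_of_hasDerivAt
    (fun x _ => h.hasDerivAt x) (h.continuous.intervalIntegrable _ _), h.add_pi]
  ring

theorem integral_abs_sin (h : IsAngle ν ρ m M) (α : ℝ) :
    ∫ β, |sin (ν β - ν α)| * ρ β ∂period = 2 := by
  have hper : Function.Periodic (fun β => |sin (ν β - ν α)| * ρ β) π := by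
    intro β
    simp only
    rw [h.periodic, h.add_pi, show ν β + π - ν α = (ν β - ν α) + π by ring, sin_add_pi, abs_neg]
  rw [integral_periodic hper α]
  have h1 : ∫ β in α..(α + π), |sin (ν β - ν α)| * ρ β
      = ∫ β in α..(α + π), sin (ν β - ν α) * ρ β := by
    refine intervalIntegral.integral_congr fun β hβ => ?_
    rw [uIcc_of_le (by linarith [pi_pos])] at hβ
    have h3 := h.strictMono.monotone hβ.1
    have h4 := h.strictMono.monotone hβ.2
    rw [h.add_pi] at h4
    rw [abs_of_nonneg (sin_nonneg_of_nonneg_of_le_pi (by linarith) (by linarith))]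
  have hc := h.nu_continuous
  have hr := h.continuous
  rw [h1, intervalIntegral.integral_eq_sub_of_hasDerivAt (f := fun β => -cos (ν β - ν α))
    (fun x _ => ?_) (Continuous.intervalIntegrable (by fun_prop) _ _)]
  · rw [h.add_pi, show ν α + π - ν α = π by ring]
    simp; norm_num
  · have := (((h.hasDerivAt x).sub_const (ν α)).cos).neg
    rw [neg_mul, neg_neg] at this
    exact this

theorem integral_orient_cos (h : IsAngle ν ρ m M) (α : ℝ) :
    ∫ β, orient α β * cos (ν β - ν α) * ρ β ∂period = 0 := by
  have hper : Function.Periodic (fun β => orient α β * cos (ν β - ν α) * ρ β) π := by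
    intro β
    simp only
    rw [h.periodic, h.add_pi, orient_add_pi, show ν β + π - ν α = (ν β - ν α) + π by ring,
      cos_add_pi]
    ring
  rw [integral_periodic hper α]
  have h1 : ∫ β in α..(α + π), orient α β * cos (ν β - ν α) * ρ β
      = ∫ β in α..(α + π), cos (ν β - ν α) * ρ β := by
    rw [intervalIntegral.integral_of_le (by linarith [pi_pos]),
      intervalIntegral.integral_of_le (by linarith [pi_pos]), integral_Ioc_eq_integral_Ioo,
      integral_Ioc_eq_integral_Ioo]
    refine setIntegral_congr_fun measurableSet_Ioo fun β hβ => ?_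
    rw [orient_of_lt hβ.1 hβ.2, one_mul]
  have hc := h.nu_continuous
  have hr := h.continuous
  rw [h1, intervalIntegral.integral_eq_sub_of_hasDerivAt (f := fun β => sin (ν β - ν α))
    (fun x _ => ?_) (Continuous.intervalIntegrable (by fun_prop) _ _)]
  · rw [h.add_pi, show ν α + π - ν α = π by ring]
    simp
  · exact ((h.hasDerivAt x).sub_const (ν α)).sin

end IsAngle

end CircleHull

namespace CircleHull

/-! ### Kernels close to a product, and coercivity of the second variation -/

/-- A symmetric `π`-periodic kernel `p`, bounded by `M`, which is `θ`-close to the product kernel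
`ρ α * ρ β` uniformly in `L¹`. -/
structure IsKernel (p : ℝ → ℝ → ℝ) (ρ : ℝ → ℝ) (M θ : ℝ) : Prop where
  measurable : Measurable (fun z : ℝ × ℝ => p z.1 z.2)
  bound : ∀ α β, |p α β| ≤ M
  symm : ∀ α β, p β α = p α β
  add_pi : ∀ α β, p α (β + π) = p α β
  continuousAt : ∀ α β, sin (β - α) ≠ 0 → ContinuousAt (fun x => p x β) α
  close : ∀ α, ∫ β, |p α β - ρ α * ρ β| ∂period ≤ θ

variable {ν ρ : ℝ → ℝ} {m M θ e : ℝ} {p : ℝ → ℝ → ℝ} {η : ℝ → ℝ}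

namespace IsAngle

/-- Integration of the product kernel against a function of the first variable. -/
theorem integral_abs_sin_mul_fst (h : IsAngle ν ρ m M) {g : ℝ → ℝ} (hg : BddMeas g) :
    ∫ z, ρ z.1 * ρ z.2 * |sin (ν z.2 - ν z.1)| * g z.1 ∂period2 = 2 * ∫ x, ρ x * g x ∂period := by
  have hr := h.bddMeas_rho
  have hn := h.nu_continuous.measurable
  rw [integral_period2 (by fun_prop), ← integral_const_mul]
  refine integral_congr_ae (ae_of_all _ fun α => ?_)
  have : ∀ β, ρ α * ρ β * |sin (ν β - ν α)| * g α
      = (ρ α * g α) * (|sin (ν β - ν α)| * ρ β) := fun β => by ring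
  simp only [this]
  rw [integral_const_mul, h.integral_abs_sin]; ring

theorem integral_abs_sin_mul_snd (h : IsAngle ν ρ m M) {g : ℝ → ℝ} (hg : BddMeas g) :
    ∫ z, ρ z.1 * ρ z.2 * |sin (ν z.2 - ν z.1)| * g z.2 ∂period2 = 2 * ∫ x, ρ x * g x ∂period := by
  rw [← h.integral_abs_sin_mul_fst hg, ← integral_period2_swap]
  refine integral_congr_ae (ae_of_all _ fun z => ?_)
  simp only
  rw [← neg_sub (ν z.2) (ν z.1), sin_neg, abs_neg]; ring

theorem integral_rho_mul_fst (h : IsAngle ν ρ m M) (g : ℝ → ℝ) :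
    ∫ z, ρ z.1 * ρ z.2 * g z.1 ∂period2 = π * ∫ x, ρ x * g x ∂period := by
  have := integral_period2_mul (fun x => ρ x * g x) ρ
  rw [h.integral_rho, mul_comm] at this
  rw [← this]
  exact integral_congr_ae (ae_of_all _ fun z => by ring)

theorem integral_rho_mul_snd (h : IsAngle ν ρ m M) (g : ℝ → ℝ) :
    ∫ z, ρ z.1 * ρ z.2 * g z.2 ∂period2 = π * ∫ x, ρ x * g x ∂period := by
  rw [← h.integral_rho_mul_fst g, ← integral_period2_swap]
  exact integral_congr_ae (ae_of_all _ fun z => by ring)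

theorem integral_rho_mul_mul (ρ f g : ℝ → ℝ) :
    ∫ z, ρ z.1 * ρ z.2 * (f z.1 * g z.2) ∂period2
      = (∫ x, ρ x * f x ∂period) * ∫ x, ρ x * g x ∂period := by
  rw [← integral_period2_mul]
  exact integral_congr_ae (ae_of_all _ fun z => by ring)

end IsAngle

namespace IsKernel

theorem bound_nonneg (hp : IsKernel p ρ M θ) : 0 ≤ M := (abs_nonneg _).trans (hp.bound 0 0)

theorem bddMeas (hp : IsKernel p ρ M θ) : BddMeas (fun z : ℝ × ℝ => p z.1 z.2) :=
  ⟨hp.measurable, M, fun _ => hp.bound _ _⟩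

/-- The error committed by replacing `p` by the product kernel and `ν + η` by `ν`. -/
def err (p : ℝ → ℝ → ℝ) (ρ : ℝ → ℝ) (M e : ℝ) (z : ℝ × ℝ) : ℝ :=
  |p z.1 z.2 - ρ z.1 * ρ z.2| + 2 * e * M

theorem bddMeas_err (hp : IsKernel p ρ M θ) (h : IsAngle ν ρ m M) (e : ℝ) :
    BddMeas (err p ρ M e) := by
  have hr := h.bddMeas_rho
  have hb := hp.bddMeas
  unfold err; fun_prop

theorem err_swap (hp : IsKernel p ρ M θ) (α β : ℝ) :
    err p ρ M e (β, α) = err p ρ M e (α, β) := by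
  simp only [err, hp.symm α β, mul_comm (ρ β)]

theorem integral_err_le (hp : IsKernel p ρ M θ) (h : IsAngle ν ρ m M) (e α : ℝ) :
    ∫ β, err p ρ M e (α, β) ∂period ≤ θ + 2 * π * e * M := by
  have hr := h.bddMeas_rho
  have hb : BddMeas (fun β => |p α β - ρ α * ρ β|) := by
    have := hp.bddMeas.section α
    fun_prop
  unfold err
  rw [integral_add (hb.integrable _) ((BddMeas.const _).integrable _), integral_period_const]
  linarith [hp.close α]

theorem err_nonneg (hp : IsKernel p ρ M θ) (he : 0 ≤ e) (z : ℝ × ℝ) : 0 ≤ err p ρ M e z := by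
  have := hp.bound_nonneg
  unfold err; positivity

/-- The two-variable form of `|e^{i (x + a)} - e^{i x}| ≤ |a|`. -/
theorem abs_rot_sub_le (x a X Y H : ℝ) (hH : 0 ≤ H) (hXY : X ^ 2 + Y ^ 2 ≤ H ^ 2) :
    |(sin (x + a) * X + cos (x + a) * Y) - (sin x * X + cos x * Y)| ≤ |a| * H := by
  have h1 : (sin (x + a) * X + cos (x + a) * Y) - (sin x * X + cos x * Y)
      = 2 * sin (a / 2) * (cos (x + a / 2) * X - sin (x + a / 2) * Y) := by
    have e1 : sin (x + a) - sin x = 2 * sin (a / 2) * cos (x + a / 2) := by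
      rw [sin_sub_sin]; ring_nf
    have e2 : cos (x + a) - cos x = -2 * sin (x + a / 2) * sin (a / 2) := by
      rw [cos_sub_cos]; ring_nf
    linear_combination X * e1 + Y * e2
  have h2 : |cos (x + a / 2) * X - sin (x + a / 2) * Y| ≤ H := by
    refine abs_le_of_sq_le_sq ?_ hH
    nlinarith [sq_nonneg (sin (x + a / 2) * X + cos (x + a / 2) * Y),
      sin_sq_add_cos_sq (x + a / 2)]
  have h3 : |2 * sin (a / 2)| ≤ |a| := by
    rw [abs_mul, abs_two]
    have := abs_sin_le_abs (x := a / 2)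
    rw [abs_div, abs_two] at this
    linarith
  rw [h1, abs_mul]
  exact mul_le_mul h3 h2 (abs_nonneg _) (abs_nonneg _)

/-- Pointwise comparison of the perturbed rotated kernel with the product kernel. -/
theorem abs_kernel_sub_le (hp : IsKernel p ρ M θ) (hη : ∀ x, |η x| ≤ e) (α β X Y H : ℝ)
    (hH : 0 ≤ H) (hXY : X ^ 2 + Y ^ 2 ≤ H ^ 2) :
    |orient α β * p α β * (sin (ν β - ν α + (η β - η α)) * X + cos (ν β - ν α + (η β - η α)) * Y)
      - orient α β * (ρ α * ρ β) * (sin (ν β - ν α) * X + cos (ν β - ν α) * Y)|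
      ≤ err p ρ M e (α, β) * H := by
  set x := ν β - ν α
  set a := η β - η α
  have ha : |a| ≤ 2 * e := (abs_sub _ _).trans (by linarith [hη α, hη β])
  have h1 := abs_rot_sub_le x a X Y H hH hXY
  have h2 : |sin x * X + cos x * Y| ≤ H := by
    refine abs_le_of_sq_le_sq ?_ hH
    nlinarith [sq_nonneg (cos x * X - sin x * Y), sin_sq_add_cos_sq x]
  have h3 := abs_orient_le α β
  have h4 := hp.bound α β
  have hM := hp.bound_nonneg
  rw [show orient α β * p α β * (sin (x + a) * X + cos (x + a) * Y)
      - orient α β * (ρ α * ρ β) * (sin x * X + cos x * Y)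
      = orient α β * (p α β * ((sin (x + a) * X + cos (x + a) * Y) - (sin x * X + cos x * Y))
        + (p α β - ρ α * ρ β) * (sin x * X + cos x * Y)) by ring, abs_mul]
  have h5 : |p α β * ((sin (x + a) * X + cos (x + a) * Y) - (sin x * X + cos x * Y))|
      ≤ M * (2 * e * H) := by
    rw [abs_mul]
    exact mul_le_mul h4 (h1.trans (mul_le_mul_of_nonneg_right ha hH)) (abs_nonneg _) hM
  have h6 : |(p α β - ρ α * ρ β) * (sin x * X + cos x * Y)| ≤ |p α β - ρ α * ρ β| * H := by
    rw [abs_mul]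
    exact mul_le_mul_of_nonneg_left h2 (abs_nonneg _)
  have h7 := (abs_add_le _ _).trans (add_le_add h5 h6)
  calc _ ≤ 1 * (M * (2 * e * H) + |p α β - ρ α * ρ β| * H) :=
        mul_le_mul h3 h7 (abs_nonneg _) zero_le_one
    _ = _ := by simp only [err]; ring

theorem kernel_sin_ge (hp : IsKernel p ρ M θ) (h : IsAngle ν ρ m M) (hη : ∀ x, |η x| ≤ e)
    (α β : ℝ) :
    ρ α * ρ β * |sin (ν β - ν α)| - err p ρ M e (α, β)
      ≤ orient α β * p α β * sin (ν β - ν α + (η β - η α)) := by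
  have := (abs_le.1 (hp.abs_kernel_sub_le (ν := ν) hη α β 1 0 1 zero_le_one (by norm_num))).1
  rw [← h.orient_mul_sin]
  simp only [mul_one, mul_zero, add_zero] at this
  linarith

theorem integral_err_mul_le (hp : IsKernel p ρ M θ) (h : IsAngle ν ρ m M) (e : ℝ) {g : ℝ → ℝ}
    (hg : BddMeas g) (h0 : ∀ x, 0 ≤ g x) :
    ∫ z, err p ρ M e z * (g z.1 + g z.2) ∂period2
      ≤ 2 * (θ + 2 * π * e * M) * ∫ x, g x ∂period := by
  have hE := hp.bddMeas_err h e
  have h1 := integral_mul_fst_le hE (hp.integral_err_le h e) hg h0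
  have h2 := integral_mul_snd_le hE hp.err_swap (hp.integral_err_le h e) hg h0
  have : ∀ z : ℝ × ℝ, err p ρ M e z * (g z.1 + g z.2)
      = err p ρ M e z * g z.1 + err p ρ M e z * g z.2 := fun z => by ring
  simp only [this]
  rw [integral_add (BddMeas.integrable (by fun_prop) _) (BddMeas.integrable (by fun_prop) _)]
  linarith

/-- Coercivity of the second variation on functions of mean zero. -/
theorem coercive (hp : IsKernel p ρ M θ) (h : IsAngle ν ρ m M) (hη : ∀ x, |η x| ≤ e)
    (hηm : Measurable η) {ζ : ℝ → ℝ} (hζ : BddMeas ζ) (h0 : ∫ x, ζ x ∂period = 0) :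
    ((4 - π) * m - 4 * (θ + 2 * π * e * M)) * ∫ x, ζ x ^ 2 ∂period
      ≤ ∫ z, orient z.1 z.2 * p z.1 z.2 * sin (ν z.2 - ν z.1 + (η z.2 - η z.1))
          * (ζ z.2 - ζ z.1) ^ 2 ∂period2 := by
  have hr := h.bddMeas_rho
  have hb := hp.bddMeas
  have hn := h.nu_continuous.measurable
  have hE := hp.bddMeas_err h e
  set k := (∫ x, ρ x * ζ x ∂period) / π with hk
  set χ : ℝ → ℝ := fun x => ζ x - k with hχ
  have hχm : BddMeas χ := by fun_prop
  have hχ0 : ∫ x, ρ x * χ x ∂period = 0 := by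
    simp only [hχ, mul_sub]
    rw [integral_sub (BddMeas.integrable (by fun_prop) _) (BddMeas.integrable (by fun_prop) _),
      integral_mul_const, h.integral_rho, hk]
    field_simp
    ring
  have hpt : ∀ z : ℝ × ℝ,
      (ρ z.1 * ρ z.2 * |sin (ν z.2 - ν z.1)| * χ z.1 ^ 2
        + ρ z.1 * ρ z.2 * |sin (ν z.2 - ν z.1)| * χ z.2 ^ 2)
      - (1 / 2 * (ρ z.1 * ρ z.2 * χ z.1 ^ 2) + 1 / 2 * (ρ z.1 * ρ z.2 * χ z.2 ^ 2))
      - ρ z.1 * ρ z.2 * (χ z.1 * χ z.2)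
      - 2 * (err p ρ M e z * (ζ z.1 ^ 2 + ζ z.2 ^ 2))
      ≤ orient z.1 z.2 * p z.1 z.2 * sin (ν z.2 - ν z.1 + (η z.2 - η z.1))
          * (ζ z.2 - ζ z.1) ^ 2 := by
    rintro ⟨α, β⟩
    simp only
    have h1 := hp.kernel_sin_ge h hη α β
    have h2 : err p ρ M e (α, β) * (ζ β - ζ α) ^ 2
        ≤ 2 * (err p ρ M e (α, β) * (ζ α ^ 2 + ζ β ^ 2)) := by
      have he : 0 ≤ e := (abs_nonneg _).trans (hη 0)
      have := hp.err_nonneg (ρ := ρ) he (α, β)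
      nlinarith [mul_nonneg this (sq_nonneg (ζ β + ζ α))]
    have h3 : ζ β - ζ α = χ β - χ α := by simp only [hχ]; ring
    have h4 := mul_le_mul_of_nonneg_right h1 (sq_nonneg (ζ β - ζ α))
    have h5 : 0 ≤ ρ α * ρ β := mul_nonneg (h.rho_pos α).le (h.rho_pos β).le
    have h6 : (2 * |sin (ν β - ν α)| - 1) * (χ α * χ β) ≤ 1 / 2 * (χ α ^ 2 + χ β ^ 2) := by
      have s0 := abs_nonneg (sin (ν β - ν α))
      have s1 := abs_sin_le_one (ν β - ν α)
      nlinarith [mul_nonneg s0 (sq_nonneg (χ α - χ β)),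
        mul_nonneg (sub_nonneg.2 s1) (sq_nonneg (χ α + χ β))]
    have h7 := mul_le_mul_of_nonneg_left h6 h5
    have h8 : ρ α * ρ β * |sin (ν β - ν α)| * (ζ β - ζ α) ^ 2
        = ρ α * ρ β * |sin (ν β - ν α)| * (χ α ^ 2 + χ β ^ 2)
          - 2 * (ρ α * ρ β * |sin (ν β - ν α)|) * (χ α * χ β) := by rw [h3]; ring
    nlinarith [h2, h4, h7, h8]
  have hint := integral_mono (BddMeas.integrable (by fun_prop) period2)
    (BddMeas.integrable (by fun_prop) period2) hpt
  refine le_trans ?_ hint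
  rw [integral_sub (BddMeas.integrable (by fun_prop) _) (BddMeas.integrable (by fun_prop) _),
    integral_sub (BddMeas.integrable (by fun_prop) _) (BddMeas.integrable (by fun_prop) _),
    integral_sub (BddMeas.integrable (by fun_prop) _) (BddMeas.integrable (by fun_prop) _),
    integral_add (BddMeas.integrable (by fun_prop) _) (BddMeas.integrable (by fun_prop) _),
    integral_add (BddMeas.integrable (by fun_prop) _) (BddMeas.integrable (by fun_prop) _),
    integral_const_mul, integral_const_mul, integral_const_mul,
    h.integral_abs_sin_mul_fst (g := fun x => χ x ^ 2) (by fun_prop),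
    h.integral_abs_sin_mul_snd (g := fun x => χ x ^ 2) (by fun_prop),
    h.integral_rho_mul_fst (fun x => χ x ^ 2), h.integral_rho_mul_snd (fun x => χ x ^ 2),
    IsAngle.integral_rho_mul_mul ρ χ χ, hχ0]
  have h9 := hp.integral_err_mul_le h e (g := fun x => ζ x ^ 2) (by fun_prop)
    (fun x => sq_nonneg _)
  have h10 : m * ∫ x, ζ x ^ 2 ∂period ≤ ∫ x, ρ x * χ x ^ 2 ∂period := by
    have h11 : ∫ x, ζ x ^ 2 ∂period ≤ ∫ x, χ x ^ 2 ∂period := by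
      have : ∀ x, χ x ^ 2 = ζ x ^ 2 + (-2 * k) * ζ x + k ^ 2 := fun x => by simp only [hχ]; ring
      simp only [this]
      rw [integral_add (BddMeas.integrable (by fun_prop) _) (BddMeas.integrable (by fun_prop) _),
        integral_add (BddMeas.integrable (by fun_prop) _) (BddMeas.integrable (by fun_prop) _),
        integral_const_mul, h0, integral_period_const]
      nlinarith [pi_pos, sq_nonneg k]
    calc _ ≤ m * ∫ x, χ x ^ 2 ∂period := mul_le_mul_of_nonneg_left h11 h.pos.le
      _ = ∫ x, m * χ x ^ 2 ∂period := (integral_const_mul _ _).symm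
      _ ≤ _ := integral_mono (((BddMeas.const m).mul (hχm.pow 2)).integrable _)
        ((hr.mul (hχm.pow 2)).integrable _)
        fun x => mul_le_mul_of_nonneg_right (h.lower x) (sq_nonneg _)
  have h12 : 0 ≤ 4 - π := by linarith [pi_lt_four]
  nlinarith [mul_le_mul_of_nonneg_left h10 h12]

end IsKernel

/-! ### Smoothness along segments -/

theorem hasDerivAt_integral_sin {X : Type*} [MeasurableSpace X] (μ : Measure X)
    [IsFiniteMeasure μ] {P A B : X → ℝ} (hP : BddMeas P) (hA : Measurable A) (hB : BddMeas B)
    (t : ℝ) :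
    HasDerivAt (fun t => ∫ z, P z * sin (A z + t * B z) ∂μ)
      (∫ z, P z * B z * sin (A z + π / 2 + t * B z) ∂μ) t := by
  have hBm := hB.measurable
  have hb : BddMeas (fun z => P z * B z) := by fun_prop
  obtain ⟨C, hC⟩ := hb.bounded
  refine (hasDerivAt_integral_of_dominated_loc_of_deriv_le (s := univ) (bound := fun _ => C)
    (F' := fun t z => P z * B z * sin (A z + π / 2 + t * B z)) Filter.univ_mem
    (Filter.Eventually.of_forall fun s => ?_) (BddMeas.integrable ?_ _) ?_
    (ae_of_all _ fun z s _ => ?_) (integrable_const _) (ae_of_all _ fun z s _ => ?_)).2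
  · exact BddMeas.measurable (by fun_prop) |>.aestronglyMeasurable
  · fun_prop
  · exact BddMeas.measurable (by fun_prop) |>.aestronglyMeasurable
  · rw [norm_mul]
    exact (mul_le_of_le_one_right (norm_nonneg _) (abs_sin_le_one _)).trans (hC z)
  · have h1 : HasDerivAt (fun s => A z + s * B z) (B z) s := by
      simpa using ((hasDerivAt_id s).mul_const (B z)).const_add (A z)
    have h2 := h1.sin.const_mul (P z)
    refine h2.congr_deriv ?_
    rw [show A z + π / 2 + s * B z = (A z + s * B z) + π / 2 by ring, sin_add_pi_div_two]
    ring

theorem contDiff_integral_sin {X : Type*} [MeasurableSpace X] (μ : Measure X)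
    [IsFiniteMeasure μ] {B : X → ℝ} (hB : BddMeas B) (n : ℕ) :
    ∀ {P A : X → ℝ}, BddMeas P → Measurable A →
      ContDiff ℝ n (fun t => ∫ z, P z * sin (A z + t * B z) ∂μ) := by
  induction n with
  | zero =>
    intro P A hP hA
    exact contDiff_zero.2 (continuous_iff_continuousAt.2 fun t =>
      (hasDerivAt_integral_sin μ hP hA hB t).continuousAt)
  | succ n ih =>
    intro P A hP hA
    have h := hasDerivAt_integral_sin μ hP hA hB
    push_cast
    refine contDiff_succ_iff_deriv.2 ⟨fun t => (h t).differentiableAt, by simp, ?_⟩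
    rw [show deriv (fun t => ∫ z, P z * sin (A z + t * B z) ∂μ) = _ from
      funext fun t => (h t).deriv]
    exact ih (by fun_prop) (by fun_prop)

theorem iteratedDeriv_two_integral_sin {X : Type*} [MeasurableSpace X] (μ : Measure X)
    [IsFiniteMeasure μ] {P A B : X → ℝ} (hP : BddMeas P) (hA : Measurable A) (hB : BddMeas B)
    (t : ℝ) :
    iteratedDeriv 2 (fun t => ∫ z, P z * sin (A z + t * B z) ∂μ) t
      = -∫ z, P z * sin (A z + t * B z) * B z ^ 2 ∂μ := by
  rw [iteratedDeriv_succ, iteratedDeriv_one,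
    show deriv (fun t => ∫ z, P z * sin (A z + t * B z) ∂μ) = _ from
      funext fun t => (hasDerivAt_integral_sin μ hP hA hB t).deriv,
    (hasDerivAt_integral_sin μ (P := fun z => P z * B z) (A := fun z => A z + π / 2)
      (by fun_prop) (by fun_prop) hB t).deriv, ← integral_neg]
  refine integral_congr_ae (ae_of_all _ fun z => ?_)
  simp only
  rw [show A z + π / 2 + π / 2 + t * B z = (A z + t * B z) + π by ring, sin_add_pi]
  ring

end CircleHull

namespace CircleHull

/-! ### Solving the Euler–Lagrange equation -/

/-- The gradient at `η` of the functional `∬ orient * p * sin (Δν + Δη) / 2`, up to sign. -/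
def gradient (p : ℝ → ℝ → ℝ) (ν η : ℝ → ℝ) (α : ℝ) : ℝ :=
  ∫ β, orient α β * p α β * cos (ν β - ν α + (η β - η α)) ∂period

theorem abs_cos_sub_cos_add_le {x b b' R : ℝ} (hb : |b| ≤ R) (hb' : |b'| ≤ R) :
    |cos (x + b) - cos (x + b') + sin x * (b - b')| ≤ R * |b - b'| := by
  have key := (convex_Icc (-R) R).norm_image_sub_le_of_norm_hasDerivWithin_le
    (f := fun y => cos (x + y) + y * sin x) (f' := fun y => -sin (x + y) + sin x) (C := R)
    (x := b') (y := b) (fun y hy => ?_) (fun y hy => ?_) (abs_le.1 hb') (abs_le.1 hb)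
  · refine le_trans (le_of_eq ?_) key
    rw [Real.norm_eq_abs]
    ring_nf
  · have h1 : HasDerivAt (fun y => x + y) 1 y := (hasDerivAt_id y).const_add x
    have h2 := h1.cos.add ((hasDerivAt_id y).mul_const (sin x))
    refine (h2.congr_deriv (by ring)).hasDerivWithinAt
  · have h1 : sin x - sin (x + y) = 2 * sin (-(y / 2)) * cos (x + y / 2) := by
      rw [sin_sub_sin]; ring_nf
    rw [Real.norm_eq_abs, neg_add_eq_sub, h1, abs_mul, abs_mul, abs_two, sin_neg, abs_neg]
    have h2 := abs_sin_le_abs (x := y / 2)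
    have h3 := abs_cos_le_one (x + y / 2)
    rw [abs_div, abs_two] at h2
    have h4 : |y| ≤ R := abs_le.2 hy
    calc 2 * |sin (y / 2)| * |cos (x + y / 2)| ≤ 2 * |sin (y / 2)| * 1 := by gcongr
      _ ≤ R := by linarith

variable {ν ρ : ℝ → ℝ} {m M θ : ℝ} {p : ℝ → ℝ → ℝ} {η : ℝ → ℝ}

theorem ae_sin_sub_ne_zero (α : ℝ) : ∀ᵐ β ∂period, sin (β - α) ≠ 0 := by
  have hc : (range fun n : ℤ => (n : ℝ) * π + α).Countable := countable_range _
  refine ae_restrict_of_ae ((hc.ae_notMem volume).mono fun β hβ h => hβ ?_)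
  obtain ⟨n, hn⟩ := sin_eq_zero_iff.1 h
  exact ⟨n, by simp only; linarith⟩

theorem orient_continuousAt {α β : ℝ} (h : sin (β - α) ≠ 0) :
    ContinuousAt (fun x => orient x β) α := by
  unfold orient
  exact ContinuousAt.div (by fun_prop) (by fun_prop) (abs_ne_zero.2 h)

namespace IsKernel

theorem bddMeas_gradient_integrand (hp : IsKernel p ρ M θ) (hn : Measurable ν)
    (hη : Measurable η) :
    BddMeas (fun z : ℝ × ℝ => orient z.1 z.2 * p z.1 z.2
      * cos (ν z.2 - ν z.1 + (η z.2 - η z.1))) := by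
  have := hp.bddMeas
  fun_prop

theorem abs_gradient_integrand_le (hp : IsKernel p ρ M θ) (ν η : ℝ → ℝ) (α β : ℝ) :
    |orient α β * p α β * cos (ν β - ν α + (η β - η α))| ≤ M := by
  rw [abs_mul, abs_mul]
  have h1 := abs_orient_le α β
  have h2 := hp.bound α β
  have h3 := abs_cos_le_one (ν β - ν α + (η β - η α))
  have h4 := hp.bound_nonneg
  calc _ ≤ 1 * M * 1 := by gcongr
    _ = M := by ring

theorem abs_gradient_le (hp : IsKernel p ρ M θ) (α : ℝ) : |gradient p ν η α| ≤ π * M := by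
  have := norm_integral_le_of_norm_le_const (μ := period) (f := fun β =>
    orient α β * p α β * cos (ν β - ν α + (η β - η α))) (C := M)
    (ae_of_all _ fun β => hp.abs_gradient_integrand_le ν η α β)
  refine this.trans (le_of_eq ?_)
  have h1 : period.real univ = π := by
    have := integral_period_const 1
    rw [integral_const, smul_eq_mul] at this
    linarith
  rw [h1]; ring

theorem continuous_gradient (hp : IsKernel p ρ M θ) (hn : Continuous ν) (hη : Continuous η) :
    Continuous (gradient p ν η) := by
  refine continuous_iff_continuousAt.2 fun α => ?_
  have hb := hp.bddMeas_gradient_integrand hn.measurable hη.measurable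
  refine continuousAt_of_dominated (bound := fun _ => M)
    (Filter.Eventually.of_forall fun x => (hb.section x).measurable.aestronglyMeasurable)
    (Filter.Eventually.of_forall fun x => ae_of_all _ fun β =>
      hp.abs_gradient_integrand_le ν η x β)
    (integrable_const _) ((ae_sin_sub_ne_zero α).mono fun β hβ => ?_)
  exact ((orient_continuousAt hβ).mul (hp.continuousAt α β hβ)).mul (by fun_prop)

theorem gradient_add_pi (hp : IsKernel p ρ M θ) (h : IsAngle ν ρ m M)
    (hη : Function.Periodic η π) (α : ℝ) : gradient p ν η (α + π) = gradient p ν η α := by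
  refine integral_congr_ae (ae_of_all _ fun β => ?_)
  simp only
  rw [← neg_neg (orient (α + π) β), ← orient_swap, orient_add_pi, ← orient_swap β α,
    ← hp.symm (α + π) β, hp.add_pi, hp.symm α β, h.add_pi, hη,
    show ν β - (ν α + π) + (η β - η α) = (ν β - ν α + (η β - η α)) - π by ring, cos_sub_pi]
  ring

theorem integral_gradient (hp : IsKernel p ρ M θ) (hn : Measurable ν) (hη : Measurable η) :
    ∫ α, gradient p ν η α ∂period = 0 := by
  unfold gradient
  rw [← integral_period2 (hp.bddMeas_gradient_integrand hn hη)]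
  have h1 : ∀ z : ℝ × ℝ, orient z.1 z.2 * p z.1 z.2 * cos (ν z.2 - ν z.1 + (η z.2 - η z.1))
      = -(orient z.2 z.1 * p z.2 z.1 * cos (ν z.1 - ν z.2 + (η z.1 - η z.2))) := by
    intro z
    rw [orient_swap z.1 z.2, hp.symm z.1 z.2, ← cos_neg (ν z.1 - ν z.2 + (η z.1 - η z.2))]
    ring_nf
  have h2 := integral_period2_swap
    (fun z => orient z.1 z.2 * p z.1 z.2 * cos (ν z.2 - ν z.1 + (η z.2 - η z.1)))
  have h3 := integral_congr_ae (μ := period2) (ae_of_all _ h1)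
  rw [integral_neg] at h3
  simp only at h2
  linarith

theorem abs_gradient_zero_le (hp : IsKernel p ρ M θ) (h : IsAngle ν ρ m M) (α : ℝ) :
    |gradient p ν (fun _ => 0) α| ≤ θ := by
  have hr := h.bddMeas_rho
  have hn := h.nu_continuous.measurable
  have ho := bddMeas_orient.section α
  have hb := hp.bddMeas.section α
  simp only at ho hb
  have h1 : gradient p ν (fun _ => 0) α
      = ∫ β, orient α β * cos (ν β - ν α) * (p α β - ρ α * ρ β) ∂period := by
    have h2 : ∀ β, orient α β * cos (ν β - ν α) * (p α β - ρ α * ρ β)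
      = orient α β * p α β * cos (ν β - ν α + (0 - 0))
        - ρ α * (orient α β * cos (ν β - ν α) * ρ β) := by intro β; rw [sub_self, add_zero]; ring
    simp only [h2]
    rw [integral_sub (BddMeas.integrable (by fun_prop) _) (BddMeas.integrable (by fun_prop) _),
      integral_const_mul, h.integral_orient_cos]
    simp [gradient]
  rw [h1]
  rw [← Real.norm_eq_abs]
  refine le_trans (norm_integral_le_of_norm_le (g := fun β => |p α β - ρ α * ρ β|)
    (BddMeas.integrable (by fun_prop) _) (ae_of_all _ fun β => ?_)) (hp.close α)
  rw [Real.norm_eq_abs, abs_mul, abs_mul]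
  have h1 := abs_orient_le α β
  have h3 := abs_cos_le_one (ν β - ν α)
  calc _ ≤ 1 * 1 * |p α β - ρ α * ρ β| := by gcongr
    _ = _ := by ring

/-- The gradient is, up to a small error, `2 * ρ` times a contractive perturbation of the identity
on functions with vanishing `ρ`-weighted mean: the kernel `|sin Δν| / 2` of the linearization may
be replaced by `|sin Δν| / 2 - 1 / 4`, whose modulus is at most `1 / 4`. -/
theorem abs_gradient_sub_le (hp : IsKernel p ρ M θ) (h : IsAngle ν ρ m M) {η' : ℝ → ℝ}
    {R d : ℝ} (hη : ∀ x, |η x| ≤ R) (hη' : ∀ x, |η' x| ≤ R) (hd : ∀ x, |η x - η' x| ≤ d)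
    (hηm : Measurable η) (hηm' : Measurable η') (h0 : ∫ x, ρ x * (η x - η' x) ∂period = 0)
    (α : ℝ) :
    |2 * ρ α * (η α - η' α) - (gradient p ν η α - gradient p ν η' α)|
      ≤ (ρ α * (π / 2) + (4 * π * R * M + 2 * θ)) * d := by
  have hr := h.bddMeas_rho
  have hn := h.nu_continuous.measurable
  have ho := bddMeas_orient.section α
  have hb := hp.bddMeas.section α
  simp only at ho hb
  have hbη : BddMeas η := ⟨hηm, R, hη⟩
  have hbη' : BddMeas η' := ⟨hηm', R, hη'⟩
  have e1 : ∫ β, ρ α * ρ β * |sin (ν β - ν α)| * (η α - η' α) ∂period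
      = 2 * ρ α * (η α - η' α) := by
    have : ∀ β, ρ α * ρ β * |sin (ν β - ν α)| * (η α - η' α)
      = (ρ α * (η α - η' α)) * (|sin (ν β - ν α)| * ρ β) := fun β => by ring
    simp only [this]
    rw [integral_const_mul, h.integral_abs_sin]; ring
  have e2 : ∫ β, ρ α / 2 * (ρ β * (η β - η' β)) ∂period = 0 := by
    rw [integral_const_mul, h0, mul_zero]
  have e3 : 2 * ρ α * (η α - η' α) - (gradient p ν η α - gradient p ν η' α)
      = ∫ β, (ρ α * ρ β * |sin (ν β - ν α)| * (η α - η' α)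
        - (orient α β * p α β * cos (ν β - ν α + (η β - η α))
          - orient α β * p α β * cos (ν β - ν α + (η' β - η' α)))
        - ρ α / 2 * (ρ β * (η β - η' β))) ∂period := by
    rw [integral_sub (BddMeas.integrable (by fun_prop) _) (BddMeas.integrable (by fun_prop) _),
      integral_sub (BddMeas.integrable (by fun_prop) _) (BddMeas.integrable (by fun_prop) _),
      integral_sub (BddMeas.integrable (by fun_prop) _) (BddMeas.integrable (by fun_prop) _),
      e1, e2]
    simp [gradient]
  have e4 : ∫ β, ((ρ α * (1 / 2) * ρ β + 4 * R * M) + 2 * |p α β - ρ α * ρ β|) * d ∂period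
      ≤ (ρ α * (π / 2) + (4 * π * R * M + 2 * θ)) * d := by
    rw [integral_mul_const,
      integral_add (BddMeas.integrable (by fun_prop) _) (BddMeas.integrable (by fun_prop) _),
      integral_add (BddMeas.integrable (by fun_prop) _) (BddMeas.integrable (by fun_prop) _),
      integral_const_mul, integral_const_mul, h.integral_rho, integral_period_const]
    refine mul_le_mul_of_nonneg_right ?_ ((abs_nonneg _).trans (hd 0))
    linarith [hp.close α, integral_const_mul (μ := period) 2 fun β => |p α β - ρ α * ρ β|]
  rw [e3]
  rw [← Real.norm_eq_abs]
  refine le_trans (norm_integral_le_of_norm_le (g := fun β =>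
    ((ρ α * (1 / 2) * ρ β + 4 * R * M) + 2 * |p α β - ρ α * ρ β|) * d)
    (BddMeas.integrable (by fun_prop) _) (ae_of_all _ fun β => ?_)) e4
  have hb1 : |η β - η α| ≤ 2 * R := (abs_sub _ _).trans (by linarith [hη α, hη β])
  have hb2 : |η' β - η' α| ≤ 2 * R := (abs_sub _ _).trans (by linarith [hη' α, hη' β])
  set s := sin (ν β - ν α) with hs
  set c1 := cos (ν β - ν α + (η β - η α))
  set c2 := cos (ν β - ν α + (η' β - η' α))
  have h1 := abs_cos_sub_cos_add_le (x := ν β - ν α) hb1 hb2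
  have hD : |(η β - η α) - (η' β - η' α)| ≤ 2 * d := by
    rw [show (η β - η α) - (η' β - η' α) = (η β - η' β) - (η α - η' α) by ring]
    exact (abs_sub _ _).trans (by linarith [hd α, hd β])
  set D := (η β - η α) - (η' β - η' α) with hDdef
  have hos : orient α β * s = |s| := h.orient_mul_sin α β
  have hR : 0 ≤ R := (abs_nonneg _).trans (hη 0)
  have hd0 : 0 ≤ d := (abs_nonneg _).trans (hd 0)
  have hs1 : |s| ≤ 1 := abs_sin_le_one _
  have hkey : ρ α * ρ β * |s| * (η α - η' α) - (orient α β * p α β * c1 - orient α β * p α β * c2)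
        - ρ α / 2 * (ρ β * (η β - η' β))
      = ρ α * ρ β * (|s| - 1 / 2) * (η β - η' β) - orient α β * p α β * (c1 - c2 + s * D)
        + (p α β - ρ α * ρ β) * |s| * D := by
    rw [← hos, hDdef]; ring
  rw [Real.norm_eq_abs, hkey]
  have t1 : |ρ α * ρ β * (|s| - 1 / 2) * (η β - η' β)| ≤ ρ α * ρ β * (1 / 2) * d := by
    have hpos : 0 < ρ α * ρ β := mul_pos (h.rho_pos α) (h.rho_pos β)
    rw [abs_mul, abs_mul, abs_of_pos hpos]
    have : |(|s| - 1 / 2)| ≤ 1 / 2 := abs_le.2 ⟨by linarith [abs_nonneg s], by linarith⟩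
    exact mul_le_mul (mul_le_mul_of_nonneg_left this hpos.le) (hd β) (abs_nonneg _) (by positivity)
  have t2 : |orient α β * p α β * (c1 - c2 + s * D)| ≤ 1 * M * (2 * R * (2 * d)) := by
    rw [abs_mul, abs_mul]
    have := hp.bound_nonneg
    exact mul_le_mul (mul_le_mul (abs_orient_le _ _) (hp.bound _ _) (abs_nonneg _) zero_le_one)
      (h1.trans (mul_le_mul_of_nonneg_left hD (by positivity))) (abs_nonneg _) (by positivity)
  have t3 : |(p α β - ρ α * ρ β) * |s| * D| ≤ |p α β - ρ α * ρ β| * 1 * (2 * d) := by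
    rw [abs_mul, abs_mul, abs_abs]
    gcongr
  calc _ ≤ ρ α * ρ β * (1 / 2) * d + 1 * M * (2 * R * (2 * d))
        + |p α β - ρ α * ρ β| * 1 * (2 * d) :=
        (abs_add_le _ _).trans (add_le_add ((abs_sub _ _).trans (add_le_add t1 t2)) t3)
    _ = _ := by ring

/-- The simplified Newton step for the equation `gradient p ν η = 0`. -/
def newton (hp : IsKernel p ρ M θ) (h : IsAngle ν ρ m M) (η : ℝ →ᵇ ℝ) : ℝ →ᵇ ℝ :=
  η - BoundedContinuousFunction.ofNormedAddCommGroup (fun α => gradient p ν η α / (2 * ρ α))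
    (by
      have h1 := hp.continuous_gradient h.nu_continuous η.continuous
      have h2 := h.continuous
      exact h1.div (by fun_prop) fun α => (mul_pos two_pos (h.rho_pos α)).ne')
    (π * M / (2 * m)) (fun α => by
      have hM := hp.bound_nonneg
      have h1 := h.pos
      have h2 := h.lower α
      have h3 := h.rho_pos α
      rw [norm_div, Real.norm_eq_abs, Real.norm_eq_abs, abs_of_pos (by linarith : 0 < 2 * ρ α)]
      exact div_le_div₀ (by positivity) (hp.abs_gradient_le α) (by linarith) (by linarith))

theorem newton_apply (hp : IsKernel p ρ M θ) (h : IsAngle ν ρ m M) (η : ℝ →ᵇ ℝ) (α : ℝ) :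
    hp.newton h η α = η α - gradient p ν η α / (2 * ρ α) := rfl

/-- If the kernel is close to the product kernel, the Euler–Lagrange equation has a small
solution. -/
theorem exists_gradient_eq_zero (hp : IsKernel p ρ M θ) (h : IsAngle ν ρ m M) {R : ℝ}
    (hR : 0 < R) (h1 : 4 * π * R * M + 2 * θ ≤ m / 5) (h2 : θ ≤ m * R / 5) :
    ∃ η : ℝ →ᵇ ℝ, Function.Periodic η π ∧ (∀ x, |η x| ≤ 5 * θ / m) ∧
      (∀ x, |η x| ≤ R) ∧ ∀ α, gradient p ν η α = 0 := by
  have hm := h.pos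
  set S : Set (ℝ →ᵇ ℝ) := {η | Function.Periodic η π ∧ ∫ x, ρ x * η x ∂period = 0 ∧
    ‖η‖ ≤ R} with hS
  have hr := h.bddMeas_rho
  have hbd : ∀ η : ℝ →ᵇ ℝ, BddMeas η := fun η =>
    ⟨η.continuous.measurable, ‖η‖, η.norm_coe_le_norm⟩
  have hSc : IsClosed S := by
    have e1 : S = (⋂ x, {η : ℝ →ᵇ ℝ | η (x + π) = η x}) ∩
        ({η : ℝ →ᵇ ℝ | ∫ x, ρ x * η x ∂period = 0} ∩ {η | ‖η‖ ≤ R}) := by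
      ext η; simp [hS, Function.Periodic]
    have hev : ∀ x, Continuous fun η : ℝ →ᵇ ℝ => η x := fun x =>
      (BoundedContinuousFunction.lipschitz_eval_const x).continuous
    rw [e1]
    refine (isClosed_iInter fun x => isClosed_eq (hev _) (hev _)).inter
      ((isClosed_eq ?_ continuous_const).inter (isClosed_le continuous_norm continuous_const))
    refine continuous_iff_continuousAt.2 fun η₀ => ?_
    refine continuousAt_of_dominated (bound := fun _ => M * (‖η₀‖ + 1))
      (Filter.Eventually.of_forall fun η => (hr.mul (hbd η)).measurable.aestronglyMeasurable)
      ?_ (integrable_const _) (ae_of_all _ fun x => ((hev x).continuousAt.const_mul _))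
    have : ∀ᶠ η : ℝ →ᵇ ℝ in nhds η₀, ‖η‖ < ‖η₀‖ + 1 :=
      continuous_norm.continuousAt.eventually (gt_mem_nhds (by linarith))
    filter_upwards [this] with η hη
    refine ae_of_all _ fun x => ?_
    rw [norm_mul, Real.norm_eq_abs, abs_of_pos (h.rho_pos x)]
    exact mul_le_mul (h.upper x) ((η.norm_coe_le_norm x).trans hη.le) (norm_nonneg _)
      hp.bound_nonneg
  -- the Newton step contracts by the factor `9 / 10`
  have hlip : ∀ η ∈ S, ∀ η' ∈ S, dist (hp.newton h η) (hp.newton h η') ≤ 9 / 10 * dist η η' := by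
    intro η hη η' hη'
    refine (BoundedContinuousFunction.dist_le (by positivity)).2 fun α => ?_
    have hdist : ∀ x, |η x - η' x| ≤ dist η η' := fun x =>
      (Real.dist_eq _ _).symm.le.trans (BoundedContinuousFunction.dist_coe_le_dist x)
    have key := hp.abs_gradient_sub_le h (η := η) (η' := η') (R := R)
      (fun x => (η.norm_coe_le_norm x).trans hη.2.2)
      (fun x => (η'.norm_coe_le_norm x).trans hη'.2.2) hdist
      η.continuous.measurable η'.continuous.measurable (by
        simp only [mul_sub]
        rw [integral_sub ((hr.mul (hbd η)).integrable _) ((hr.mul (hbd η')).integrable _),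
          hη.2.1, hη'.2.1, sub_zero]) α
    have hρ := h.rho_pos α
    have e1 : η α - gradient p ν η α / (2 * ρ α) - (η' α - gradient p ν η' α / (2 * ρ α))
        = (2 * ρ α * (η α - η' α) - (gradient p ν η α - gradient p ν η' α)) / (2 * ρ α) := by
      field_simp
      ring
    rw [Real.dist_eq, newton_apply, newton_apply, e1, abs_div,
      abs_of_pos (by linarith : 0 < 2 * ρ α), div_le_iff₀ (by linarith)]
    refine key.trans ?_
    rw [show 9 / 10 * dist η η' * (2 * ρ α) = (9 / 5 * ρ α) * dist η η' by ring]
    refine mul_le_mul_of_nonneg_right ?_ dist_nonneg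
    have := h.lower α
    have := mul_le_mul_of_nonneg_left pi_lt_d2.le hρ.le
    linarith
  have hzero : ‖hp.newton h 0‖ ≤ θ / (2 * m) := by
    have hθ : 0 ≤ θ := (abs_nonneg _).trans (hp.abs_gradient_zero_le h 0)
    refine (BoundedContinuousFunction.norm_le (by positivity)).2 fun α => ?_
    have := hp.abs_gradient_zero_le h α
    have hρ := h.rho_pos α
    rw [newton_apply, BoundedContinuousFunction.coe_zero, Pi.zero_apply, zero_sub, norm_neg,
      norm_div, Real.norm_eq_abs, Real.norm_eq_abs, abs_of_pos (by linarith : 0 < 2 * ρ α)]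
    exact div_le_div₀ hθ this (by linarith) (by linarith [h.lower α])
  have h0S : (0 : ℝ →ᵇ ℝ) ∈ S := ⟨fun x => rfl, by simp, by simpa using hR.le⟩
  have hgrow : ∀ η ∈ S, ‖hp.newton h η‖ ≤ 9 / 10 * ‖η‖ + θ / (2 * m) := by
    intro η hη
    have := hlip η hη 0 h0S
    rw [dist_eq_norm, dist_eq_norm, sub_zero] at this
    have h3 := norm_add_le (hp.newton h η - hp.newton h 0) (hp.newton h 0)
    rw [sub_add_cancel] at h3
    linarith
  have hθ' : θ / (2 * m) ≤ R / 10 := by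
    rw [div_le_iff₀ (by positivity)]; linarith
  have hmaps : MapsTo (hp.newton h) S S := by
    intro η hη
    refine ⟨fun x => ?_, ?_, ?_⟩
    · rw [newton_apply, newton_apply, hp.gradient_add_pi h hη.1, hη.1, h.periodic]
    · have e1 : ∀ x, ρ x * hp.newton h η x = ρ x * η x - 1 / 2 * gradient p ν η x := by
        intro x
        have := h.rho_pos x
        rw [newton_apply]; field_simp
      have hg : BddMeas (gradient p ν η) :=
        ⟨(hp.continuous_gradient h.nu_continuous η.continuous).measurable, _,
          hp.abs_gradient_le⟩
      simp only [e1]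
      rw [integral_sub ((hr.mul (hbd η)).integrable _)
        (((BddMeas.const _).mul hg).integrable _), hη.2.1, integral_const_mul,
        hp.integral_gradient h.nu_continuous.measurable η.continuous.measurable]
      ring
    · have := hgrow η hη
      have := hη.2.2
      linarith
  have hcontr : ContractingWith (9 / 10 : NNReal) (hmaps.restrict (hp.newton h) S S) := by
    refine ⟨?_, LipschitzWith.of_dist_le_mul fun x y => ?_⟩
    · rw [div_lt_one (by norm_num)]; norm_num
    · have := hlip x x.2 y y.2
      rw [Subtype.dist_eq, Subtype.dist_eq]
      simpa using this
  obtain ⟨η, hηS, hfix, -⟩ := ContractingWith.exists_fixedPoint' hSc.isComplete hmaps hcontr h0S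
    (edist_ne_top _ _)
  have hfix : hp.newton h η = η := hfix
  have hnorm : ‖η‖ ≤ 5 * θ / m := by
    have := hgrow η hηS
    rw [hfix] at this
    have e1 : 5 * θ / m = 10 * (θ / (2 * m)) := by field_simp; ring
    rw [e1]; linarith
  refine ⟨η, hηS.1, fun x => (η.norm_coe_le_norm x).trans hnorm,
    fun x => (η.norm_coe_le_norm x).trans hηS.2.2, fun α => ?_⟩
  have h3 := hp.newton_apply h η α
  rw [hfix] at h3
  have h4 : gradient p ν η α / (2 * ρ α) = 0 := by linarith
  rcases div_eq_zero_iff.1 h4 with h5 | h5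
  · exact h5
  · have := h.rho_pos α
    linarith

end IsKernel

end CircleHull

namespace CircleHull

/-! ### Critical points are global maxima -/

variable {ν ρ : ℝ → ℝ} {m M θ e : ℝ} {p : ℝ → ℝ → ℝ} {η : ℝ → ℝ}

theorem IsAngle.abs_orient_sub_le (h : IsAngle ν ρ m M) (α β : ℝ) :
    |orient α β - sin (ν β - ν α)| ≤ 1 - |sin (ν β - ν α)| := by
  have h1 := h.orient_mul_sin α β
  have h2 := abs_sin_le_one (ν β - ν α)
  set s := sin (ν β - ν α)
  by_cases h0 : sin (β - α) = 0
  · have : orient α β = 0 := by simp [orient, h0]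
    rw [this, zero_mul] at h1
    rw [← h1, this, abs_eq_zero.1 h1.symm]; simp
  · have : orient α β = 1 ∨ orient α β = -1 := by
      rcases lt_or_gt_of_ne h0 with h' | h'
      · right; rw [orient, abs_of_neg h', div_neg, div_self h0]
      · left; rw [orient, abs_of_pos h', div_self h0]
    rcases this with h' | h'
    · rw [h', one_mul] at h1
      rw [h', ← h1, abs_of_nonneg]; linarith [h1, le_abs_self s]
    · rw [h'] at h1
      rw [h', ← h1]
      have : (-1 : ℝ) - s = -(1 + s) := by ring
      rw [this, abs_neg, abs_of_nonneg (by linarith [neg_abs_le s])]; linarith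

/-- For the product kernel, the symbol `orient * e^{i Δν}` is compared with
`sin Δν * e^{i Δν}`, whose quadratic form is explicit. -/
theorem IsAngle.orient_rot_le (h : IsAngle ν ρ m M) (α β X Y H : ℝ)
    (hH : 0 ≤ H) (hXY : X ^ 2 + Y ^ 2 ≤ H ^ 2) :
    orient α β * (sin (ν β - ν α) * X + cos (ν β - ν α) * Y)
      ≤ (1 - |sin (ν β - ν α)|) * H
        + (X - (cos (2 * ν β - 2 * ν α) * X - sin (2 * ν β - 2 * ν α) * Y)) / 2 := by
  have h1 := h.abs_orient_sub_le α β
  set t := ν β - ν α with ht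
  have h2 : |sin t * X + cos t * Y| ≤ H := by
    refine abs_le_of_sq_le_sq ?_ hH
    nlinarith [sq_nonneg (cos t * X - sin t * Y), sin_sq_add_cos_sq t]
  have h3 : (orient α β - sin t) * (sin t * X + cos t * Y) ≤ (1 - |sin t|) * H := by
    refine (le_abs_self _).trans ?_
    rw [abs_mul]
    exact mul_le_mul h1 h2 (abs_nonneg _) ((abs_nonneg _).trans h1)
  rw [show 2 * ν β - 2 * ν α = 2 * t by rw [ht]; ring, cos_two_mul, sin_two_mul]
  have h4 : sin t ^ 2 = 1 - cos t ^ 2 := sin_sq t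
  linear_combination h3 + X * h4

namespace IsKernel

/-- Nonnegativity of the certificate form on functions with vanishing `ρ`-weighted mean. -/
theorem certificate_nonneg_of_mean (hp : IsKernel p ρ M θ) (h : IsAngle ν ρ m M)
    (hη : ∀ x, |η x| ≤ e) (hηm : Measurable η) (hsmall : 2 * (θ + 2 * π * e * M) ≤ (4 - π) * m)
    {x y : ℝ → ℝ} (hx : BddMeas x) (hy : BddMeas y) (hx0 : ∫ t, ρ t * x t ∂period = 0)
    (hy0 : ∫ t, ρ t * y t ∂period = 0) :
    0 ≤ ∫ z, orient z.1 z.2 * p z.1 z.2 *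
      (sin (ν z.2 - ν z.1 + (η z.2 - η z.1)) * ((x z.1 - x z.2) ^ 2 + (y z.1 - y z.2) ^ 2) / 2
        - cos (ν z.2 - ν z.1 + (η z.2 - η z.1)) * (x z.1 * y z.2 - y z.1 * x z.2)) ∂period2 := by
  have hr := h.bddMeas_rho
  have hb := hp.bddMeas
  have hn := h.nu_continuous.measurable
  have hE := hp.bddMeas_err h e
  set g : ℝ → ℝ := fun t => x t ^ 2 + y t ^ 2 with hg
  have hgm : BddMeas g := by fun_prop
  have hg0 : ∀ t, 0 ≤ g t := fun t => by positivity
  set X : ℝ → ℝ := fun t => cos (2 * ν t) * x t - sin (2 * ν t) * y t with hX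
  set Y : ℝ → ℝ := fun t => sin (2 * ν t) * x t + cos (2 * ν t) * y t with hY
  have hXm : BddMeas X := by fun_prop
  have hYm : BddMeas Y := by fun_prop
  have hpt : ∀ z : ℝ × ℝ,
      (ρ z.1 * ρ z.2 * |sin (ν z.2 - ν z.1)| * g z.1
        + ρ z.1 * ρ z.2 * |sin (ν z.2 - ν z.1)| * g z.2)
      - (1 / 2 * (ρ z.1 * ρ z.2 * g z.1) + 1 / 2 * (ρ z.1 * ρ z.2 * g z.2))
      - err p ρ M e z * (g z.1 + g z.2)
      - (1 / 2 * (ρ z.1 * ρ z.2 * (x z.1 * x z.2)) + 1 / 2 * (ρ z.1 * ρ z.2 * (y z.1 * y z.2)))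
      + (1 / 2 * (ρ z.1 * ρ z.2 * (X z.1 * X z.2)) + 1 / 2 * (ρ z.1 * ρ z.2 * (Y z.1 * Y z.2)))
      ≤ orient z.1 z.2 * p z.1 z.2 *
      (sin (ν z.2 - ν z.1 + (η z.2 - η z.1)) * ((x z.1 - x z.2) ^ 2 + (y z.1 - y z.2) ^ 2) / 2
        - cos (ν z.2 - ν z.1 + (η z.2 - η z.1)) * (x z.1 * y z.2 - y z.1 * x z.2)) := by
    rintro ⟨α, β⟩
    simp only
    set H := (g α + g β) / 2 with hH
    set U := x α * x β + y α * y β with hU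
    set V := x α * y β - y α * x β with hV
    have hH0 : 0 ≤ H := by have := hg0 α; have := hg0 β; positivity
    have hUV : U ^ 2 + V ^ 2 ≤ H ^ 2 := by
      have : U ^ 2 + V ^ 2 = g α * g β := by simp only [hU, hV, hg]; ring
      rw [this, hH]; nlinarith [sq_nonneg (g α - g β)]
    have h1 := mul_le_mul_of_nonneg_right (hp.kernel_sin_ge h hη α β) hH0
    have h2 := (abs_le.1 (hp.abs_kernel_sub_le (ν := ν) hη α β U V H hH0 hUV)).2
    have h5 : 0 ≤ ρ α * ρ β := mul_nonneg (h.rho_pos α).le (h.rho_pos β).le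
    have h3 := mul_le_mul_of_nonneg_left (h.orient_rot_le α β U V H hH0 hUV) h5
    have h4 : cos (2 * ν β - 2 * ν α) * U - sin (2 * ν β - 2 * ν α) * V
        = X α * X β + Y α * Y β := by
      rw [cos_sub, sin_sub]; simp only [hU, hV, hX, hY]; ring
    have h6 : ((x α - x β) ^ 2 + (y α - y β) ^ 2) / 2 = H - U := by
      simp only [hH, hU, hg]; ring
    rw [h4] at h3
    rw [mul_div_assoc, h6]
    have e1 : x α * x β = U - y α * y β := by rw [hU]; ring
    have e2 : g α = 2 * H - g β := by rw [hH]; ring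
    rw [e1, e2]
    linarith
  have hint := integral_mono (BddMeas.integrable (by fun_prop) period2)
    (BddMeas.integrable (by fun_prop) period2) hpt
  refine le_trans ?_ hint
  rw [integral_add (BddMeas.integrable (by fun_prop) _) (BddMeas.integrable (by fun_prop) _),
    integral_sub (BddMeas.integrable (by fun_prop) _) (BddMeas.integrable (by fun_prop) _),
    integral_sub (BddMeas.integrable (by fun_prop) _) (BddMeas.integrable (by fun_prop) _),
    integral_sub (BddMeas.integrable (by fun_prop) _) (BddMeas.integrable (by fun_prop) _),
    integral_add (BddMeas.integrable (by fun_prop) _) (BddMeas.integrable (by fun_prop) _),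
    integral_add (BddMeas.integrable (by fun_prop) _) (BddMeas.integrable (by fun_prop) _),
    integral_add (BddMeas.integrable (by fun_prop) _) (BddMeas.integrable (by fun_prop) _),
    integral_add (BddMeas.integrable (by fun_prop) _) (BddMeas.integrable (by fun_prop) _)]
  simp only [integral_const_mul]
  rw [h.integral_abs_sin_mul_fst hgm, h.integral_abs_sin_mul_snd hgm,
    h.integral_rho_mul_fst g, h.integral_rho_mul_snd g,
    IsAngle.integral_rho_mul_mul ρ x x, IsAngle.integral_rho_mul_mul ρ y y,
    IsAngle.integral_rho_mul_mul ρ X X, IsAngle.integral_rho_mul_mul ρ Y Y, hx0, hy0]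
  have h9 := hp.integral_err_mul_le h e hgm hg0
  have h10 : m * ∫ t, g t ∂period ≤ ∫ t, ρ t * g t ∂period := by
    rw [← integral_const_mul]
    exact integral_mono (((BddMeas.const m).mul hgm).integrable _) ((hr.mul hgm).integrable _)
      fun t => mul_le_mul_of_nonneg_right (h.lower t) (hg0 t)
  have h11 : 0 ≤ ∫ t, g t ∂period := integral_nonneg hg0
  have h12 : 0 ≤ 4 - π := by linarith [pi_lt_four]
  nlinarith [mul_le_mul_of_nonneg_left h10 h12, mul_le_mul_of_nonneg_right hsmall h11,
    mul_self_nonneg (∫ t, ρ t * X t ∂period), mul_self_nonneg (∫ t, ρ t * Y t ∂period)]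

theorem integral_cos_mul_fst (hp : IsKernel p ρ M θ) (hn : Measurable ν)
    (hηm : Measurable η) (hcrit : ∀ α, gradient p ν η α = 0) {x : ℝ → ℝ} (hx : BddMeas x) :
    ∫ z, orient z.1 z.2 * p z.1 z.2 * cos (ν z.2 - ν z.1 + (η z.2 - η z.1)) * x z.1 ∂period2
      = 0 := by
  have hb := hp.bddMeas
  rw [integral_period2 (by fun_prop)]
  simp only [integral_mul_const]
  have : ∀ α, ∫ β, orient α β * p α β * cos (ν β - ν α + (η β - η α)) ∂period = 0 := hcrit
  simp [this]

theorem integral_cos_mul_snd (hp : IsKernel p ρ M θ) (hn : Measurable ν)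
    (hηm : Measurable η) (hcrit : ∀ α, gradient p ν η α = 0) {x : ℝ → ℝ} (hx : BddMeas x) :
    ∫ z, orient z.1 z.2 * p z.1 z.2 * cos (ν z.2 - ν z.1 + (η z.2 - η z.1)) * x z.2 ∂period2
      = 0 := by
  rw [← integral_period2_swap, ← neg_eq_zero, ← integral_neg,
    ← hp.integral_cos_mul_fst hn hηm hcrit hx]
  refine integral_congr_ae (ae_of_all _ fun z => ?_)
  simp only
  rw [orient_swap z.1 z.2, hp.symm z.1 z.2,
    show ν z.1 - ν z.2 + (η z.1 - η z.2) = -(ν z.2 - ν z.1 + (η z.2 - η z.1)) by ring, cos_neg]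
  ring

/-- Nonnegativity of the certificate form at a critical point. Criticality makes the form invariant
under adding constants, so that the weighted means may be assumed to vanish. -/
theorem certificate_nonneg (hp : IsKernel p ρ M θ) (h : IsAngle ν ρ m M)
    (hη : ∀ x, |η x| ≤ e) (hηm : Measurable η) (hcrit : ∀ α, gradient p ν η α = 0)
    (hsmall : 2 * (θ + 2 * π * e * M) ≤ (4 - π) * m)
    {x y : ℝ → ℝ} (hx : BddMeas x) (hy : BddMeas y) :
    0 ≤ ∫ z, orient z.1 z.2 * p z.1 z.2 *
      (sin (ν z.2 - ν z.1 + (η z.2 - η z.1)) * ((x z.1 - x z.2) ^ 2 + (y z.1 - y z.2) ^ 2) / 2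
        - cos (ν z.2 - ν z.1 + (η z.2 - η z.1)) * (x z.1 * y z.2 - y z.1 * x z.2)) ∂period2 := by
  have hr := h.bddMeas_rho
  have hb := hp.bddMeas
  have hn := h.nu_continuous.measurable
  have hmean : ∀ {x : ℝ → ℝ}, BddMeas x →
      ∫ t, ρ t * (x t - (∫ t, ρ t * x t ∂period) / π) ∂period = 0 := by
    intro x hx
    simp only [mul_sub]
    rw [integral_sub (BddMeas.integrable (by fun_prop) _) (BddMeas.integrable (by fun_prop) _),
      integral_mul_const, h.integral_rho]
    field_simp
    ring
  set a := (∫ t, ρ t * x t ∂period) / π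
  set b := (∫ t, ρ t * y t ∂period) / π
  have key := hp.certificate_nonneg_of_mean h hη hηm hsmall (x := fun t => x t - a)
    (y := fun t => y t - b) (by fun_prop) (by fun_prop) (hmean hx) (hmean hy)
  set c : ℝ × ℝ → ℝ := fun z =>
    orient z.1 z.2 * p z.1 z.2 * cos (ν z.2 - ν z.1 + (η z.2 - η z.1)) with hc
  have hcm : BddMeas c := by fun_prop
  have h1 : ∀ z : ℝ × ℝ, orient z.1 z.2 * p z.1 z.2 *
      (sin (ν z.2 - ν z.1 + (η z.2 - η z.1)) * ((x z.1 - a - (x z.2 - a)) ^ 2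
          + (y z.1 - b - (y z.2 - b)) ^ 2) / 2
        - cos (ν z.2 - ν z.1 + (η z.2 - η z.1))
          * ((x z.1 - a) * (y z.2 - b) - (y z.1 - b) * (x z.2 - a)))
      = orient z.1 z.2 * p z.1 z.2 *
      (sin (ν z.2 - ν z.1 + (η z.2 - η z.1)) * ((x z.1 - x z.2) ^ 2 + (y z.1 - y z.2) ^ 2) / 2
        - cos (ν z.2 - ν z.1 + (η z.2 - η z.1)) * (x z.1 * y z.2 - y z.1 * x z.2))
      + (c z * (b * x z.1 - a * y z.1) + c z * (a * y z.2 - b * x z.2)) := by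
    intro z; simp only [hc]; ring
  simp only [h1] at key
  rw [integral_add (BddMeas.integrable (by fun_prop) _) (BddMeas.integrable (by fun_prop) _),
    integral_add (BddMeas.integrable (by fun_prop) _) (BddMeas.integrable (by fun_prop) _),
    hp.integral_cos_mul_fst hn hηm hcrit (x := fun t => b * x t - a * y t) (by fun_prop),
    hp.integral_cos_mul_snd hn hηm hcrit (x := fun t => a * y t - b * x t) (by fun_prop)] at key
  linarith

/-- A small critical point maximizes the two-form among all pairs with `v ^ 2 + w ^ 2 ≤ 1`. -/
theorem form_le_of_critical (hp : IsKernel p ρ M θ) (h : IsAngle ν ρ m M)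
    (hη : ∀ x, |η x| ≤ e) (hηm : Measurable η) (hcrit : ∀ α, gradient p ν η α = 0)
    (hsmall : 2 * (θ + 2 * π * e * M) ≤ (4 - π) * m)
    {v w : ℝ → ℝ} (hv : Measurable v) (hw : Measurable w) (hvw : ∀ x, v x ^ 2 + w x ^ 2 ≤ 1) :
    ∫ z, orient z.1 z.2 * p z.1 z.2 * (v z.1 * w z.2 - v z.2 * w z.1) ∂period2
      ≤ ∫ z, orient z.1 z.2 * p z.1 z.2 * sin (ν z.2 - ν z.1 + (η z.2 - η z.1)) ∂period2 := by
  have hb := hp.bddMeas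
  have hn := h.nu_continuous.measurable
  have hvm : BddMeas v := ⟨hv, 1, fun x => abs_le_of_sq_le_sq
    (by nlinarith [hvw x, sq_nonneg (w x)]) zero_le_one⟩
  have hwm : BddMeas w := ⟨hw, 1, fun x => abs_le_of_sq_le_sq
    (by nlinarith [hvw x, sq_nonneg (v x)]) zero_le_one⟩
  set φ : ℝ → ℝ := fun t => ν t + η t with hφ
  have hφm : Measurable φ := by fun_prop
  have hΔ : ∀ α β, ν β - ν α + (η β - η α) = φ β - φ α := fun α β => by simp only [hφ]; ring
  set x : ℝ → ℝ := fun t => cos (φ t) * v t + sin (φ t) * w t with hx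
  set y : ℝ → ℝ := fun t => cos (φ t) * w t - sin (φ t) * v t with hy
  have hxm : BddMeas x := by fun_prop
  have hym : BddMeas y := by fun_prop
  have key := hp.certificate_nonneg h hη hηm hcrit hsmall hxm hym
  set g : ℝ → ℝ := fun t => v t ^ 2 + w t ^ 2 with hg
  have hgm : BddMeas g := by fun_prop
  set k : ℝ × ℝ → ℝ := fun z =>
    orient z.1 z.2 * p z.1 z.2 * sin (ν z.2 - ν z.1 + (η z.2 - η z.1)) with hk
  have hkm : BddMeas k := by fun_prop
  have hks : ∀ α β, k (β, α) = k (α, β) := by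
    intro α β
    simp only [hk]
    rw [orient_swap α β, hp.symm α β,
      show ν α - ν β + (η α - η β) = -(ν β - ν α + (η β - η α)) by ring, sin_neg]
    ring
  have h1 : ∀ z : ℝ × ℝ, orient z.1 z.2 * p z.1 z.2 *
      (sin (ν z.2 - ν z.1 + (η z.2 - η z.1)) * ((x z.1 - x z.2) ^ 2 + (y z.1 - y z.2) ^ 2) / 2
        - cos (ν z.2 - ν z.1 + (η z.2 - η z.1)) * (x z.1 * y z.2 - y z.1 * x z.2))
      = (1 / 2 * (k z * g z.1) + 1 / 2 * (k z * g z.2))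
        - orient z.1 z.2 * p z.1 z.2 * (v z.1 * w z.2 - v z.2 * w z.1) := by
    rintro ⟨α, β⟩
    simp only [hk, hΔ]
    have a1 : x α ^ 2 + y α ^ 2 = g α := by
      simp only [hx, hy, hg]
      linear_combination (v α ^ 2 + w α ^ 2) * sin_sq_add_cos_sq (φ α)
    have a2 : x β ^ 2 + y β ^ 2 = g β := by
      simp only [hx, hy, hg]
      linear_combination (v β ^ 2 + w β ^ 2) * sin_sq_add_cos_sq (φ β)
    have a3 : sin (φ β - φ α) * (x α * x β + y α * y β)
        + cos (φ β - φ α) * (x α * y β - y α * x β) = v α * w β - v β * w α := by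
      have b1 : x α * x β + y α * y β = cos (φ β - φ α) * (v α * v β + w α * w β)
          + sin (φ β - φ α) * (v α * w β - w α * v β) := by
        rw [cos_sub, sin_sub]; simp only [hx, hy]; ring
      have b2 : x α * y β - y α * x β = cos (φ β - φ α) * (v α * w β - w α * v β)
          - sin (φ β - φ α) * (v α * v β + w α * w β) := by
        rw [cos_sub, sin_sub]; simp only [hx, hy]; ring
      rw [b1, b2]
      linear_combination (v α * w β - w α * v β) * sin_sq_add_cos_sq (φ β - φ α)
    rw [← a1, ← a2, ← a3]; ring
  simp only [h1] at key
  rw [integral_sub (BddMeas.integrable (by fun_prop) _) (BddMeas.integrable (by fun_prop) _),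
    integral_add (BddMeas.integrable (by fun_prop) _) (BddMeas.integrable (by fun_prop) _),
    integral_const_mul, integral_const_mul] at key
  have h2 : ∫ z, k z * g z.2 ∂period2 = ∫ z, k z * g z.1 ∂period2 := by
    rw [← integral_period2_swap]
    exact integral_congr_ae (ae_of_all _ fun z => by simp only [hks])
  -- the weights `∫ k (α, β) dβ` are nonnegative since they are close to `2 * ρ α`
  have hk0 : ∀ α, 0 ≤ ∫ β, k (α, β) ∂period := by
    intro α
    have hr := h.bddMeas_rho
    have hE := (hp.bddMeas_err h e).section α
    have hks' := hkm.section α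
    have b1 : ∫ β, (ρ α * (|sin (ν β - ν α)| * ρ β) - err p ρ M e (α, β)) ∂period
        ≤ ∫ β, k (α, β) ∂period := by
      refine integral_mono (BddMeas.integrable (by fun_prop) _) (hks'.integrable _) fun β => ?_
      have := hp.kernel_sin_ge h hη α β
      simp only [hk]
      linarith
    rw [integral_sub (BddMeas.integrable (by fun_prop) _) (hE.integrable _), integral_const_mul,
      h.integral_abs_sin] at b1
    have b2 := hp.integral_err_le h e α
    have b3 := h.lower α
    have b4 := h.pos
    nlinarith [pi_gt_three]
  have h3 : ∫ z, k z * g z.1 ∂period2 ≤ ∫ z, k z ∂period2 := by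
    rw [integral_period2 (by fun_prop), integral_period2 hkm]
    simp only [integral_mul_const]
    refine integral_mono ((hkm.integral_right.mul hgm).integrable _)
      (hkm.integral_right.integrable _) fun α => ?_
    exact mul_le_of_le_one_right (hk0 α) (hvw α)
  linarith

end IsKernel

end CircleHull

namespace CircleHull

/-! ### The coefficient on the injective hull -/

theorem coeff_swap (f : ℝ → ℝ) (α β : ℝ) : coeff f β α = coeff f α β := by
  unfold coeff
  rw [← neg_sub β α, cos_neg, sin_neg]
  ring

theorem coeff_add_pi {f : ℝ →ᵇ ℝ} (hf : f ∈ hull) (α β : ℝ) :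
    coeff f α (β + π) = coeff f α β := by
  have h1 : f (β + π) = π - f β := by linarith [hf.2 β]
  unfold coeff
  rw [h1, show β + π - α = (β - α) + π by ring, cos_add_pi, sin_add_pi, cos_pi_sub, sin_pi_sub]
  ring

theorem abs_sub_le_of_mem_hull {f : ℝ →ᵇ ℝ} (hf : f ∈ hull) (α β : ℝ) :
    |f α - f β| ≤ |β - α| := by
  have := hf.1.dist_le_mul α β
  rw [Real.dist_eq, Real.dist_eq, abs_sub_comm α β] at this
  simpa using this

theorem abs_sin_half_sub_le {f : ℝ →ᵇ ℝ} (hf : f ∈ hull) (α β : ℝ) :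
    |sin ((f α - f β) / 2)| ≤ |sin ((β - α) / 2)| := by
  have h2 : ∀ x, f (x + 2 * π) = f x := fun x => by
    have h3 := hf.2 x
    have h4 := hf.2 (x + π)
    rw [show x + 2 * π = x + π + π by ring]
    linarith
  have hper : Function.Periodic
      (fun β => |sin ((β - α) / 2)| - |sin ((f α - f β) / 2)|) (2 * π) := by
    intro β
    simp only
    rw [h2, show (β + 2 * π - α) / 2 = (β - α) / 2 + π by ring, sin_add_pi, abs_neg]
  obtain ⟨γ, hγ, he⟩ := hper.exists_mem_Ico two_pi_pos β (α - π)
  have h5 : |γ - α| ≤ π := abs_le.2 ⟨by linarith [hγ.1], by linarith [hγ.2]⟩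
  have h6 := abs_sub_le_of_mem_hull hf α γ
  have h7 : ∀ x, |x| ≤ π → |sin (x / 2)| = sin (|x| / 2) := by
    intro x hx
    rw [abs_sin_eq_sin_abs_of_abs_le_pi (by rw [abs_div, abs_two]; linarith [abs_nonneg x]),
      abs_div, abs_two]
  have h8 : |sin ((f α - f γ) / 2)| ≤ |sin ((γ - α) / 2)| := by
    rw [h7 _ h5, h7 _ (h6.trans h5)]
    refine sin_le_sin_of_le_of_le_pi_div_two ?_ ?_ ?_ <;>
      linarith [abs_nonneg (f α - f γ), pi_pos]
  linarith

theorem abs_cos_half_add_le {f : ℝ →ᵇ ℝ} (hf : f ∈ hull) (α β : ℝ) :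
    |cos ((f α + f β) / 2)| ≤ |cos ((β - α) / 2)| := by
  have h := abs_sin_half_sub_le hf α (β + π)
  have h1 : f (β + π) = π - f β := by linarith [hf.2 β]
  rwa [h1, show (f α - (π - f β)) / 2 = (f α + f β) / 2 - π / 2 by ring,
    show (β + π - α) / 2 = (β - α) / 2 + π / 2 by ring, sin_sub_pi_div_two, sin_add_pi_div_two,
    abs_neg] at h

/-- The coefficient in half-angle form; for `f` in the hull the two squared quotients are at most
`1`. -/
theorem coeff_eq {f : ℝ → ℝ} {α β : ℝ} (h : sin (β - α) ≠ 0) :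
    coeff f α β = (1 - (sin ((f α - f β) / 2) / sin ((β - α) / 2)) ^ 2)
      * (1 - (cos ((f α + f β) / 2) / cos ((β - α) / 2)) ^ 2)
      * (1 / (sin (f α) ^ 2 * sin (f β) ^ 2)) := by
  set S := sin ((β - α) / 2) with hS
  set K := cos ((β - α) / 2) with hK
  have e1 : sin (β - α) = 2 * S * K := by
    rw [hS, hK, ← sin_two_mul]; congr 1; ring
  rw [e1] at h
  have hS0 : S ≠ 0 := fun h0 => h (by rw [h0]; ring)
  have hK0 : K ≠ 0 := fun h0 => h (by rw [h0]; ring)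
  have e2 : cos (β - α) = 2 * K ^ 2 - 1 := by
    rw [hK, ← cos_two_mul]; congr 1; ring
  have e3 : S ^ 2 + K ^ 2 = 1 := sin_sq_add_cos_sq _
  set P := sin ((f α - f β) / 2) with hP
  set Q := cos ((f α + f β) / 2) with hQ
  have e4 : cos (f α) * cos (f β) + sin (f α) * sin (f β) = 1 - 2 * P ^ 2 := by
    rw [← cos_sub, hP, sin_sq_eq_half_sub]
    rw [show 2 * ((f α - f β) / 2) = f α - f β by ring]; ring
  have e5 : cos (f α) * cos (f β) - sin (f α) * sin (f β) = 2 * Q ^ 2 - 1 := by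
    rw [← cos_add, hQ, ← cos_two_mul]; congr 1; ring
  have e6 : 1 - cos (β - α) ^ 2 - cos (f α) ^ 2 - cos (f β) ^ 2
      + 2 * cos (β - α) * cos (f α) * cos (f β) = 4 * (S ^ 2 - P ^ 2) * (K ^ 2 - Q ^ 2) := by
    have e7 : 1 - cos (β - α) ^ 2 - cos (f α) ^ 2 - cos (f β) ^ 2
      + 2 * cos (β - α) * cos (f α) * cos (f β)
      = (cos (f α) * cos (f β) + sin (f α) * sin (f β) - cos (β - α))
        * (cos (β - α) - (cos (f α) * cos (f β) - sin (f α) * sin (f β))) := by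
      linear_combination (-1 + cos (f β) ^ 2) * sin_sq_add_cos_sq (f α)
        - sin (f α) ^ 2 * sin_sq_add_cos_sq (f β)
    rw [e7, e4, e5, e2]
    linear_combination (-4 * (K ^ 2 - Q ^ 2)) * e3
  unfold coeff
  rw [e6, e1]
  by_cases h1 : sin (f α) = 0
  · simp [h1]
  by_cases h2 : sin (f β) = 0
  · simp [h2]
  field_simp
  ring

theorem sq_div_mem_Icc {a b : ℝ} (h : |a| ≤ |b|) : 1 - (a / b) ^ 2 ∈ Icc (0 : ℝ) 1 := by
  have h1 : (a / b) ^ 2 ≤ 1 := by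
    rw [div_pow]
    exact div_le_one_of_le₀ (sq_le_sq.2 h) (sq_nonneg _)
  exact ⟨by linarith, by linarith [sq_nonneg (a / b)]⟩

theorem one_div_mem_Icc {s a b : ℝ} (hs : 0 < s) (ha : s ≤ sin a) (hb : s ≤ sin b) :
    1 / (sin a ^ 2 * sin b ^ 2) ∈ Icc 0 (1 / s ^ 4) := by
  refine ⟨by positivity, one_div_le_one_div_of_le (by positivity) ?_⟩
  calc s ^ 4 = s ^ 2 * s ^ 2 := by ring
    _ ≤ _ := by gcongr

theorem abs_coeff_le {f : ℝ →ᵇ ℝ} (hf : f ∈ hull) {s : ℝ} (hs : 0 < s)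
    (hfs : ∀ α, s ≤ sin (f α)) (α β : ℝ) : |coeff f α β| ≤ 1 / s ^ 4 := by
  by_cases h : sin (β - α) = 0
  · simp only [coeff, h]
    simp; positivity
  rw [coeff_eq h]
  have h1 := sq_div_mem_Icc (abs_sin_half_sub_le hf α β)
  have h2 := sq_div_mem_Icc (abs_cos_half_add_le hf α β)
  have h3 := one_div_mem_Icc hs (hfs α) (hfs β)
  rw [abs_of_nonneg (mul_nonneg (mul_nonneg h1.1 h2.1) h3.1)]
  calc _ ≤ 1 * 1 * (1 / s ^ 4) := mul_le_mul (mul_le_mul h1.2 h2.2 h2.1 zero_le_one) h3.2 h3.1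
        (by norm_num)
    _ = _ := by ring

theorem abs_sin_sub_sin_le (x y : ℝ) : |sin x - sin y| ≤ |x - y| := by
  rw [sin_sub_sin, abs_mul, abs_mul, abs_two]
  have h1 := abs_sin_le_abs (x := (x - y) / 2)
  rw [abs_div, abs_two] at h1
  have h2 := abs_cos_le_one ((x + y) / 2)
  calc _ ≤ 2 * |sin ((x - y) / 2)| * 1 := by gcongr
    _ ≤ _ := by linarith

theorem abs_cos_sub_cos_le (x y : ℝ) : |cos x - cos y| ≤ |x - y| := by
  have := abs_sin_sub_sin_le (x + π / 2) (y + π / 2)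
  rwa [sin_add_pi_div_two, sin_add_pi_div_two, add_sub_add_right_eq_sub] at this

theorem abs_sq_div_sub_le {a a' b c ε : ℝ} (hb : 0 < |b|) (hc : 0 < c) (hcb : c ≤ 2 * |b|)
    (h : |a| ≤ |b|) (h' : |a'| ≤ |b|) (hε : |a - a'| ≤ ε) :
    |(1 - (a / b) ^ 2) - (1 - (a' / b) ^ 2)| ≤ 4 * (ε / c) := by
  have h1 : (1 - (a / b) ^ 2) - (1 - (a' / b) ^ 2) = -(((a + a') / b) * ((a - a') / b)) := by ring
  have hε0 : 0 ≤ ε := (abs_nonneg _).trans hε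
  rw [h1, abs_neg, abs_mul, abs_div, abs_div]
  have h2 : |a + a'| / |b| ≤ 2 := by
    rw [div_le_iff₀ hb]; exact (abs_add_le _ _).trans (by linarith)
  have h3 : |a - a'| / |b| ≤ 2 * (ε / c) := by
    rw [div_le_iff₀ hb]
    have : ε ≤ ε / c * (2 * |b|) := by
      rw [div_mul_eq_mul_div, le_div_iff₀ hc]
      exact mul_le_mul_of_nonneg_left hcb hε0
    linarith
  calc _ ≤ 2 * (2 * (ε / c)) := mul_le_mul h2 h3 (by positivity) zero_le_two
    _ = _ := by ring

theorem abs_sin_sq_sub_le {a b ε : ℝ} (h : |a - b| ≤ ε) :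
    |sin a ^ 2 - sin b ^ 2| ≤ 2 * ε := by
  rw [show sin a ^ 2 - sin b ^ 2 = (sin a + sin b) * (sin a - sin b) by ring, abs_mul]
  have q1 := abs_add_le (sin a) (sin b)
  have q2 := abs_sin_le_one a
  have q3 := abs_sin_le_one b
  exact mul_le_mul (by linarith) ((abs_sin_sub_sin_le _ _).trans h) (abs_nonneg _) zero_le_two

theorem abs_one_div_sub_le {a b a' b' s ε t : ℝ} (hs : 0 < s) (ha : s ≤ sin a) (hb : s ≤ sin b)
    (ha' : s ≤ sin a') (hb' : s ≤ sin b') (hεa : |a - a'| ≤ ε) (hεb : |b - b'| ≤ ε)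
    (hεt : ε ≤ t) :
    |1 / (sin a ^ 2 * sin b ^ 2) - 1 / (sin a' ^ 2 * sin b' ^ 2)| ≤ 4 * t / s ^ 8 := by
  have hp : ∀ {x : ℝ}, s ≤ x → 0 < x := fun hx => hs.trans_le hx
  have p1 := hp ha
  have p2 := hp hb
  have p3 := hp ha'
  have p4 := hp hb'
  have hε : 0 ≤ ε := (abs_nonneg _).trans hεa
  have hpow : ∀ {x y : ℝ}, s ≤ x → s ≤ y → s ^ 4 ≤ x ^ 2 * y ^ 2 := fun hx hy => by
    have := mul_le_mul (pow_le_pow_left₀ hs.le hx 2) (pow_le_pow_left₀ hs.le hy 2)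
      (sq_nonneg s) (sq_nonneg _)
    calc s ^ 4 = s ^ 2 * s ^ 2 := by ring
      _ ≤ _ := this
  rw [div_sub_div _ _ (by positivity) (by positivity), abs_div, abs_of_pos
    (by positivity : 0 < sin a ^ 2 * sin b ^ 2 * (sin a' ^ 2 * sin b' ^ 2))]
  refine div_le_div₀ (by linarith) ?_ (by positivity) ?_
  · rw [show 1 * (sin a' ^ 2 * sin b' ^ 2) - sin a ^ 2 * sin b ^ 2 * 1
      = -(sin a' ^ 2 * (sin b ^ 2 - sin b' ^ 2)
        + sin b ^ 2 * (sin a ^ 2 - sin a' ^ 2)) by ring, abs_neg]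
    refine (abs_add_le _ _).trans ?_
    rw [abs_mul, abs_mul, abs_of_nonneg (sq_nonneg (sin a')), abs_of_nonneg (sq_nonneg (sin b))]
    have t1 := mul_le_mul (sin_sq_le_one a') (abs_sin_sq_sub_le hεb) (abs_nonneg _) zero_le_one
    have t2 := mul_le_mul (sin_sq_le_one b) (abs_sin_sq_sub_le hεa) (abs_nonneg _) zero_le_one
    linarith
  · have := mul_le_mul (hpow ha hb) (hpow ha' hb') (by positivity) (by positivity)
    calc s ^ 8 = s ^ 4 * s ^ 4 := by ring
      _ ≤ _ := this

theorem abs_mul_three_sub_le {u w q u' w' q' t s A : ℝ}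
    (w1 : w ∈ Icc (0 : ℝ) 1) (u2 : u' ∈ Icc (0 : ℝ) 1) (w2 : w' ∈ Icc (0 : ℝ) 1)
    (r1 : q ∈ Icc 0 A) (r2 : q ≤ 1 / s ^ 8) (du : |u - u'| ≤ 4 * t) (dw : |w - w'| ≤ 4 * t)
    (dr : |q - q'| ≤ 4 * t / s ^ 8) :
    |u * w * q - u' * w' * q'| ≤ 12 / s ^ 8 * t := by
  have ht : 0 ≤ 4 * t := (abs_nonneg _).trans du
  rw [show u * w * q - u' * w' * q' = (u - u') * (w * q) + u' * ((w - w') * q)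
    + u' * w' * (q - q') by ring]
  have b1 : |(u - u') * (w * q)| ≤ 4 * t * (1 * (1 / s ^ 8)) := by
    rw [abs_mul, abs_of_nonneg (mul_nonneg w1.1 r1.1)]
    exact mul_le_mul du (mul_le_mul w1.2 r2 r1.1 zero_le_one) (mul_nonneg w1.1 r1.1) ht
  have b2 : |u' * ((w - w') * q)| ≤ 1 * (4 * t * (1 / s ^ 8)) := by
    rw [abs_mul, abs_mul, abs_of_nonneg u2.1, abs_of_nonneg r1.1]
    exact mul_le_mul u2.2 (mul_le_mul dw r2 r1.1 ht)
      (mul_nonneg (abs_nonneg _) r1.1) zero_le_one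
  have b3 : |u' * w' * (q - q')| ≤ 1 * 1 * (4 * t / s ^ 8) := by
    rw [abs_mul, abs_of_nonneg (mul_nonneg u2.1 w2.1)]
    exact mul_le_mul (mul_le_mul u2.2 w2.2 w2.1 zero_le_one) dr (abs_nonneg _) (by norm_num)
  calc _ ≤ 4 * t * (1 * (1 / s ^ 8)) + 1 * (4 * t * (1 / s ^ 8)) + 1 * 1 * (4 * t / s ^ 8) :=
        (abs_add_le _ _).trans (add_le_add ((abs_add_le _ _).trans (add_le_add b1 b2)) b3)
    _ = _ := by ring

/-- The coefficient is Lipschitz in `f` away from the diagonal, with constant of the order of the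
inverse distance to the diagonal. -/
theorem abs_coeff_sub_le {f g : ℝ →ᵇ ℝ} (hf : f ∈ hull) (hg : g ∈ hull) {s : ℝ} (hs : 0 < s)
    (hfs : ∀ α, s ≤ sin (f α)) (hgs : ∀ α, s ≤ sin (g α)) {α β : ℝ} (h : sin (β - α) ≠ 0) :
    |coeff f α β - coeff g α β| ≤ 12 / s ^ 8 * (dist f g / |sin (β - α)|) := by
  have hs1 : s ≤ 1 := (hfs 0).trans (sin_le_one _)
  have hd : ∀ x, |f x - g x| ≤ dist f g := fun x =>
    (Real.dist_eq _ _).symm.le.trans (BoundedContinuousFunction.dist_coe_le_dist x)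
  set ε := dist f g with hεd
  have hc : 0 < |sin (β - α)| := abs_pos.2 h
  have e1 : |sin (β - α)| = 2 * |sin ((β - α) / 2)| * |cos ((β - α) / 2)| := by
    have : sin (β - α) = 2 * sin ((β - α) / 2) * cos ((β - α) / 2) := by
      rw [← sin_two_mul]; congr 1; ring
    rw [this, abs_mul, abs_mul, abs_two]
  have hS1 := abs_sin_le_one ((β - α) / 2)
  have hK1 := abs_cos_le_one ((β - α) / 2)
  have hS0 := abs_nonneg (sin ((β - α) / 2))
  have hK0 := abs_nonneg (cos ((β - α) / 2))
  have hcS : |sin (β - α)| ≤ 2 * |sin ((β - α) / 2)| := by rw [e1]; nlinarith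
  have hcK : |sin (β - α)| ≤ 2 * |cos ((β - α) / 2)| := by rw [e1]; nlinarith
  have hc1 : |sin (β - α)| ≤ 1 := abs_sin_le_one _
  set c := |sin (β - α)|
  have hε0 : 0 ≤ ε := dist_nonneg
  rw [coeff_eq h, coeff_eq h]
  have w1 := sq_div_mem_Icc (abs_cos_half_add_le hf α β)
  have u2 := sq_div_mem_Icc (abs_sin_half_sub_le hg α β)
  have w2 := sq_div_mem_Icc (abs_cos_half_add_le hg α β)
  have r1 := one_div_mem_Icc hs (hfs α) (hfs β)
  have du := abs_sq_div_sub_le (c := c) (ε := ε) (by linarith) hc hcS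
    (abs_sin_half_sub_le hf α β) (abs_sin_half_sub_le hg α β) (by
      refine (abs_sin_sub_sin_le _ _).trans ?_
      rw [show (f α - f β) / 2 - (g α - g β) / 2 = ((f α - g α) - (f β - g β)) / 2 by ring,
        abs_div, abs_two]
      linarith [(abs_sub (f α - g α) (f β - g β)), hd α, hd β])
  have dw := abs_sq_div_sub_le (c := c) (ε := ε) (by linarith) hc hcK
    (abs_cos_half_add_le hf α β) (abs_cos_half_add_le hg α β) (by
      refine (abs_cos_sub_cos_le _ _).trans ?_
      rw [show (f α + f β) / 2 - (g α + g β) / 2 = ((f α - g α) + (f β - g β)) / 2 by ring,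
        abs_div, abs_two]
      linarith [(abs_add_le (f α - g α) (f β - g β)), hd α, hd β])
  have dr := abs_one_div_sub_le hs (hfs α) (hfs β) (hgs α) (hgs β) (hd α) (hd β)
    (t := ε / c) (by rw [le_div_iff₀ hc]; exact mul_le_of_le_one_right hε0 hc1)
  have hs48 : 1 / s ^ 4 ≤ 1 / s ^ 8 :=
    one_div_le_one_div_of_le (by positivity) (pow_le_pow_of_le_one hs.le hs1 (by norm_num))
  exact abs_mul_three_sub_le w1 u2 w2 r1 (r1.2.trans hs48) du dw dr

theorem abs_coeff_sub_le_rpow {f g : ℝ →ᵇ ℝ} (hf : f ∈ hull) (hg : g ∈ hull) {s ξ : ℝ}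
    (hs : 0 < s) (hξ : ξ ∈ Ioo (0 : ℝ) 1)
    (hfs : ∀ α, s ≤ sin (f α)) (hgs : ∀ α, s ≤ sin (g α)) {α β : ℝ} (h : sin (β - α) ≠ 0) :
    |coeff f α β - coeff g α β| ≤ 12 / s ^ 8 * (dist f g ^ ξ * |sin (β - α)| ^ (-ξ)) := by
  have h1 := abs_coeff_sub_le hf hg hs hfs hgs h
  have hs1 : s ≤ 1 := (hfs 0).trans (sin_le_one _)
  have h2 : |coeff f α β - coeff g α β| ≤ 12 / s ^ 8 := by
    have a1 := abs_coeff_le hf hs hfs α β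
    have a2 := abs_coeff_le hg hs hgs α β
    have hs48 : 1 / s ^ 4 ≤ 1 / s ^ 8 :=
      one_div_le_one_div_of_le (by positivity) (pow_le_pow_of_le_one hs.le hs1 (by norm_num))
    have a3 := abs_sub (coeff f α β) (coeff g α β)
    have a4 : (12 : ℝ) / s ^ 8 = 12 * (1 / s ^ 8) := by ring
    have a5 : 0 < 1 / s ^ 8 := by positivity
    linarith
  have hc : 0 < |sin (β - α)| := abs_pos.2 h
  have hx : 0 ≤ dist f g / |sin (β - α)| := by positivity
  have h3 : dist f g ^ ξ * |sin (β - α)| ^ (-ξ) = (dist f g / |sin (β - α)|) ^ ξ := by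
    rw [div_rpow dist_nonneg hc.le, rpow_neg hc.le, div_eq_mul_inv]
  rw [h3]
  rcases le_total (dist f g / |sin (β - α)|) 1 with h4 | h4
  · refine h1.trans (mul_le_mul_of_nonneg_left ?_ (by positivity))
    have := rpow_le_rpow_of_exponent_ge' hx h4 hξ.1.le hξ.2.le
    rwa [rpow_one] at this
  · refine h2.trans (le_mul_of_one_le_right (by positivity) ?_)
    exact one_le_rpow h4 hξ.1.le

/-! ### A singular integral -/

theorem intervalIntegrable_abs_sin_rpow {ξ : ℝ} (hξ : ξ ∈ Ioo (0 : ℝ) 1) :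
    IntervalIntegrable (fun x => |sin x| ^ (-ξ)) volume 0 π := by
  have h1 : IntervalIntegrable (fun x : ℝ => x ^ (-ξ)) volume 0 π :=
    intervalIntegral.intervalIntegrable_rpow' (by linarith [hξ.2])
  have h2 : IntervalIntegrable (fun x : ℝ => (π - x) ^ (-ξ)) volume 0 π := by
    have := (h1.comp_sub_left π).symm
    simpa using this
  have h3 := (h1.add h2).const_mul ((2 / π) ^ (-ξ))
  rw [intervalIntegrable_iff_integrableOn_Ioo_of_le pi_pos.le] at h3 ⊢
  refine Integrable.mono' h3 (Measurable.aestronglyMeasurable (by measurability)) ((ae_restrict_iff' measurableSet_Ioo).2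
    (ae_of_all _ fun x hx => ?_))
  have hx0 := hx.1
  have hx1 : 0 < π - x := by linarith [hx.2]
  have hs := sin_pos_of_mem_Ioo hx
  have hpi := pi_pos
  rw [Real.norm_eq_abs, abs_of_nonneg (rpow_nonneg (abs_nonneg _) _), abs_of_pos hs]
  have key : ∀ y, 0 < y → y ≤ π / 2 → sin y ^ (-ξ) ≤ (2 / π) ^ (-ξ) * y ^ (-ξ) := by
    intro y hy0 hy1
    rw [← mul_rpow (by positivity) hy0.le]
    exact rpow_le_rpow_of_nonpos (by positivity) (mul_le_sin hy0.le hy1) (by linarith [hξ.1])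
  have p1 : 0 ≤ (2 / π) ^ (-ξ) * x ^ (-ξ) := by positivity
  have p2 : 0 ≤ (2 / π) ^ (-ξ) * (π - x) ^ (-ξ) := by positivity
  simp only [mul_add]
  rcases le_total x (π / 2) with h | h
  · linarith [key x hx0 h]
  · have := key (π - x) hx1 (by linarith)
    rw [sin_pi_sub] at this
    linarith

theorem abs_sin_rpow_periodic (ξ : ℝ) : Function.Periodic (fun x => |sin x| ^ (-ξ)) π := by
  intro x
  simp only
  rw [sin_add_pi, abs_neg]

theorem integrable_abs_sin_sub_rpow {ξ : ℝ} (hξ : ξ ∈ Ioo (0 : ℝ) 1) (α : ℝ) :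
    Integrable (fun β => |sin (β - α)| ^ (-ξ)) period := by
  have h1 := (abs_sin_rpow_periodic ξ).intervalIntegrable pi_pos.ne' (t := 0)
    (by simpa using intervalIntegrable_abs_sin_rpow hξ) (-α) (π - α)
  have h2 := h1.comp_sub_right α
  rw [neg_add_cancel, sub_add_cancel, intervalIntegrable_iff_integrableOn_Ioc_of_le pi_pos.le]
    at h2
  exact h2

theorem integral_abs_sin_sub_rpow (ξ α : ℝ) :
    ∫ β, |sin (β - α)| ^ (-ξ) ∂period = ∫ β, |sin β| ^ (-ξ) ∂period := by
  rw [← intervalIntegral_eq_period, ← intervalIntegral_eq_period,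
    intervalIntegral.integral_comp_sub_right (fun x => |sin x| ^ (-ξ)) α]
  have := (abs_sin_rpow_periodic ξ).intervalIntegral_add_eq (0 - α) 0
  rwa [zero_add, show 0 - α + π = π - α by ring] at this

end CircleHull

namespace CircleHull

/-! ### Points of the hemisphere -/

/-- The circle function with parameter `τ`. -/
def circlePoint (τ : ℝ) : ℝ →ᵇ ℝ :=
  BoundedContinuousFunction.ofNormedAddCommGroup (fun α => arccos (cos (α - τ)))
    (by fun_prop) π fun α => by
      rw [Real.norm_eq_abs, abs_of_nonneg (arccos_nonneg _)]
      exact arccos_le_pi _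

theorem abs_arccos_cos_mul_sub_le {d : ℝ} (hd : d ∈ Icc (0 : ℝ) (π / 2)) (t : ℝ) :
    |arccos (cos d * cos t) - arccos (cos t)| ≤ d := by
  set s := arccos (cos t) with hs
  have hs0 : 0 ≤ s := arccos_nonneg _
  have hs1 : s ≤ π := arccos_le_pi _
  have hcs : cos s = cos t := cos_arccos (neg_one_le_cos _) (cos_le_one _)
  have hsd : 0 ≤ sin d * sin s := mul_nonneg
    (sin_nonneg_of_nonneg_of_le_pi hd.1 (by linarith [hd.2, pi_pos]))
    (sin_nonneg_of_nonneg_of_le_pi hs0 hs1)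
  rw [← hcs, abs_le]
  constructor
  · rcases le_total s d with h | h
    · linarith [arccos_nonneg (cos d * cos s)]
    · have h1 : arccos (cos (s - d)) ≤ arccos (cos d * cos s) :=
        antitone_arccos (by rw [cos_sub]; linarith)
      rw [arccos_cos (by linarith) (by linarith [hd.1])] at h1
      linarith
  · rcases le_total (s + d) π with h | h
    · have h1 : arccos (cos d * cos s) ≤ arccos (cos (s + d)) :=
        antitone_arccos (by rw [cos_add]; linarith)
      rw [arccos_cos (by linarith [hd.1]) h] at h1
      linarith
    · linarith [arccos_le_pi (cos d * cos s)]

/-- The distance of a point of the hemisphere from the circle is its elevation. -/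
theorem infDist_circle {h : ℝ →ᵇ ℝ} {d τ : ℝ} (hd : d ∈ Icc (0 : ℝ) (π / 2))
    (hh : ∀ α, h α = arccos (cos d * cos (α - τ))) : Metric.infDist h circle = d := by
  have hmem : circlePoint τ ∈ circle := ⟨τ, fun _ => rfl⟩
  refine le_antisymm ?_ ((Metric.le_infDist ⟨_, hmem⟩).2 fun g hg => ?_)
  · refine (Metric.infDist_le_dist_of_mem hmem).trans
      ((BoundedContinuousFunction.dist_le hd.1).2 fun α => ?_)
    rw [hh, Real.dist_eq]
    exact abs_arccos_cos_mul_sub_le hd _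
  · obtain ⟨σ, hσ⟩ := hg
    have h1 : |h σ - g σ| ≤ dist h g :=
      (Real.dist_eq _ _).symm.le.trans (BoundedContinuousFunction.dist_coe_le_dist σ)
    refine le_trans ?_ ((le_abs_self _).trans h1)
    rw [hσ, sub_self, cos_zero, arccos_one, sub_zero, hh]
    have hc : 0 ≤ cos d := cos_nonneg_of_mem_Icc ⟨by linarith [hd.1, pi_pos], hd.2⟩
    have h2 : arccos (cos d) ≤ arccos (cos d * cos (σ - τ)) :=
      antitone_arccos (mul_le_of_le_one_right hc (cos_le_one _))
    rwa [arccos_cos hd.1 (by linarith [hd.2, pi_pos])] at h2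

/-- An explicit antiderivative of `k / (k ^ 2 * cos ^ 2 + sin ^ 2)`, continuous on all of `ℝ`: the
argument of `k * cos s + i * sin s`, written as `s` plus a periodic correction. -/
theorem hasDerivAt_ellipse_angle {k : ℝ} (hk : 0 < k) (s : ℝ) :
    HasDerivAt (fun s => s + arctan ((1 - k) * (sin s * cos s) / (k * cos s ^ 2 + sin s ^ 2)))
      (k / (k ^ 2 * cos s ^ 2 + sin s ^ 2)) s := by
  have hsc := sin_sq_add_cos_sq s
  have hm : 0 < k * cos s ^ 2 + sin s ^ 2 := by
    by_cases h : cos s = 0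
    · rw [h] at hsc ⊢; nlinarith
    · have : 0 < cos s ^ 2 := by positivity
      positivity
  have hq : 0 < k ^ 2 * cos s ^ 2 + sin s ^ 2 := by
    by_cases h : cos s = 0
    · rw [h] at hsc ⊢; nlinarith
    · have : 0 < cos s ^ 2 := by positivity
      positivity
  have h1 := ((hasDerivAt_sin s).mul (hasDerivAt_cos s)).const_mul (1 - k)
  have h2 := (((hasDerivAt_cos s).pow 2).const_mul k).add ((hasDerivAt_sin s).pow 2)
  have h3 := (hasDerivAt_id s).add ((h1.div h2 hm.ne').arctan)
  refine (h3.congr_deriv ?_)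
  simp only [Pi.mul_apply, Pi.add_apply, Pi.pow_apply, Pi.div_apply]
  norm_num
  set c := cos s
  set S := sin s
  have e1 : (k * c ^ 2 + S ^ 2) ^ 2 + ((1 - k) * (S * c)) ^ 2 = k ^ 2 * c ^ 2 + S ^ 2 := by
    linear_combination (k ^ 2 * c ^ 2 + S ^ 2) * hsc
  have e2 : 1 + ((1 - k) * (S * c) / (k * c ^ 2 + S ^ 2)) ^ 2
      = (k ^ 2 * c ^ 2 + S ^ 2) / (k * c ^ 2 + S ^ 2) ^ 2 := by
    rw [← e1]; field_simp
  rw [e2]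
  field_simp
  have e3 : S ^ 2 = 1 - c ^ 2 := by linarith
  have e4 : S ^ 4 = (1 - c ^ 2) ^ 2 := by rw [← e3]; ring
  ring_nf
  simp only [e3, e4]
  ring

variable {h : ℝ →ᵇ ℝ} {d τ r : ℝ}

theorem sin_sq_of_hemisphere (hh : ∀ α, h α = arccos (cos d * cos (α - τ))) (t : ℝ) :
    sin (h t) ^ 2 = sin d ^ 2 * cos (t - τ) ^ 2 + sin (t - τ) ^ 2 := by
  have h1 : |cos d * cos (t - τ)| ≤ 1 := by
    rw [abs_mul]
    exact mul_le_one₀ (abs_cos_le_one _) (abs_nonneg _) (abs_cos_le_one _)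
  rw [sin_sq, hh, cos_arccos (abs_le.1 h1).1 (abs_le.1 h1).2]
  linear_combination (-cos (t - τ) ^ 2) * sin_sq_add_cos_sq d - sin_sq_add_cos_sq (t - τ)

theorem coeff_of_hemisphere (hh : ∀ α, h α = arccos (cos d * cos (α - τ))) {α β : ℝ}
    (hne : sin (β - α) ≠ 0) :
    coeff h α β = sin d / sin (h α) ^ 2 * (sin d / sin (h β) ^ 2) := by
  have h1 : ∀ t, cos (h t) = cos d * cos (t - τ) := by
    intro t
    have h1 : |cos d * cos (t - τ)| ≤ 1 := by
      rw [abs_mul]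
      exact mul_le_one₀ (abs_cos_le_one _) (abs_nonneg _) (abs_cos_le_one _)
    rw [hh, cos_arccos (abs_le.1 h1).1 (abs_le.1 h1).2]
  have h2 : 1 - cos (β - α) ^ 2 - cos (h α) ^ 2 - cos (h β) ^ 2
      + 2 * cos (β - α) * cos (h α) * cos (h β) = sin d ^ 2 * sin (β - α) ^ 2 := by
    have hC : cos (β - α) = cos (β - τ) * cos (α - τ) + sin (β - τ) * sin (α - τ) := by
      rw [← cos_sub]; congr 1; ring
    have hS : sin (β - α) = sin (β - τ) * cos (α - τ) - cos (β - τ) * sin (α - τ) := by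
      rw [← sin_sub]; congr 1; ring
    rw [h1, h1, hC, hS, sin_sq d]
    set x := cos (α - τ)
    set y := cos (β - τ)
    have e1 : sin (α - τ) ^ 2 = 1 - x ^ 2 := sin_sq _
    have e2 : sin (β - τ) ^ 2 = 1 - y ^ 2 := sin_sq _
    set S := sin (α - τ)
    set T := sin (β - τ)
    linear_combination (cos d ^ 2 * y ^ 2 - (y ^ 2 + T ^ 2)) * e1 + (cos d ^ 2 * x ^ 2 - 1) * e2
  unfold coeff
  rw [h2]
  field_simp

/-- The derivative of `nu h`. -/
def nuDeriv (h : ℝ →ᵇ ℝ) (t : ℝ) : ℝ := sin (Metric.infDist h circle) / sin (h t) ^ 2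

theorem isAngle_nu (hr : r ∈ Ioo (0 : ℝ) (π / 2)) (hH : h ∈ hemisphere ∩ truncatedHull r) :
    IsAngle (nu h) (nuDeriv h) (sin r) (1 / sin r ^ 2) := by
  obtain ⟨⟨d, hd, τ, hh⟩, hhull, htr⟩ := hH
  have hr0 : 0 < sin r := sin_pos_of_pos_of_lt_pi hr.1 (by linarith [hr.2, pi_pos])
  have hinf := infDist_circle hd hh
  have hrd : r ≤ d := by
    have := (htr τ).1
    rwa [hh, sub_self, cos_zero, mul_one, arccos_cos hd.1 (by linarith [hd.2, pi_pos])] at this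
  have hsd : sin r ≤ sin d :=
    sin_le_sin_of_le_of_le_pi_div_two (by linarith [hr.1, pi_pos]) hd.2 hrd
  have hsh : ∀ t, sin r ≤ sin (h t) := by
    intro t
    obtain ⟨h1, h2⟩ := htr t
    rcases le_total (h t) (π / 2) with h3 | h3
    · exact sin_le_sin_of_le_of_le_pi_div_two (by linarith [hr.1, pi_pos]) h3 h1
    · rw [← sin_pi_sub (h t)]
      exact sin_le_sin_of_le_of_le_pi_div_two (by linarith [hr.1, pi_pos]) (by linarith) (by linarith)
  have hsh0 : ∀ t, 0 < sin (h t) := fun t => hr0.trans_le (hsh t)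
  have hcont : Continuous (nuDeriv h) := by
    unfold nuDeriv
    have := h.continuous
    exact Continuous.div (by fun_prop) (by fun_prop) fun t => (pow_pos (hsh0 t) 2).ne'
  have hderiv : ∀ t, HasDerivAt (nu h) (nuDeriv h t) t := fun t =>
    (hcont.integral_hasStrictDerivAt 0 t).hasDerivAt
  have hper : Function.Periodic (nuDeriv h) π := by
    intro t
    have h1 : h (t + π) = π - h t := by linarith [hhull.2 t]
    simp only [nuDeriv, h1, sin_pi_sub]
  have hanti : ∀ t, HasDerivAt (fun t => (fun s => s + arctan ((1 - sin d) * (sin s * cos s)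
      / (sin d * cos s ^ 2 + sin s ^ 2))) (t - τ)) (nuDeriv h t) t := by
    intro t
    have := (hasDerivAt_ellipse_angle (hr0.trans_le hsd) (t - τ)).comp t
      ((hasDerivAt_id t).sub_const τ)
    rw [mul_one, ← sin_sq_of_hemisphere hh t] at this
    rw [nuDeriv, hinf]
    exact this
  refine ⟨hr0, hderiv, hcont, fun t => ?_, fun t => ?_, fun t => ?_, hper⟩
  · rw [nuDeriv, hinf, le_div_iff₀ (pow_pos (hsh0 t) 2)]
    have := sin_sq_le_one (h t)
    nlinarith
  · rw [nuDeriv, hinf]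
    exact div_le_div₀ zero_le_one (sin_le_one d) (by positivity)
      (pow_le_pow_left₀ hr0.le (hsh t) 2)
  · have h1 : nu h (t + π) - nu h t = π := by
      have h2 := intervalIntegral.integral_eq_sub_of_hasDerivAt (a := t) (b := t + π)
        (fun x _ => hderiv x) (hcont.intervalIntegrable _ _)
      have h3 := intervalIntegral.integral_eq_sub_of_hasDerivAt (a := t) (b := t + π)
        (fun x _ => hanti x) (hcont.intervalIntegrable _ _)
      beta_reduce at h3
      rw [← h2, h3, show t + π - τ = (t - τ) + π by ring, sin_add_pi, cos_add_pi]
      simp only [neg_mul_neg, neg_sq]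
      ring
    linarith

theorem sin_half_le {f : ℝ →ᵇ ℝ} (hr : 0 < r) (hh : h ∈ truncatedHull r)
    (hf : dist f h ≤ r / 2) (t : ℝ) : sin (r / 2) ≤ sin (f t) := by
  have h1 : |f t - h t| ≤ dist f h :=
    (Real.dist_eq _ _).symm.le.trans (BoundedContinuousFunction.dist_coe_le_dist t)
  obtain ⟨h2, h3⟩ := abs_le.1 (h1.trans hf)
  obtain ⟨h4, h5⟩ := hh.2 t
  rcases le_total (f t) (π / 2) with h6 | h6
  · exact sin_le_sin_of_le_of_le_pi_div_two (by linarith [hr, pi_pos]) h6 (by linarith)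
  · rw [← sin_pi_sub (f t)]
    exact sin_le_sin_of_le_of_le_pi_div_two (by linarith [hr, pi_pos]) (by linarith) (by linarith)

/-- The `L¹` closeness constant of `isKernel_coeff`. -/
def closeConst (ξ r : ℝ) : ℝ := 12 / sin (r / 2) ^ 8 * ∫ β, |sin β| ^ (-ξ) ∂period

theorem measurable_coeff {f : ℝ → ℝ} (hf : Measurable f) :
    Measurable (fun z : ℝ × ℝ => coeff f z.1 z.2) := by
  unfold coeff; fun_prop

theorem isKernel_coeff {ξ : ℝ} (hξ : ξ ∈ Ioo (0 : ℝ) 1) (hr : r ∈ Ioo (0 : ℝ) (π / 2))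
    (hH : h ∈ hemisphere ∩ truncatedHull r) {f : ℝ →ᵇ ℝ} (hf : f ∈ hull)
    (hfh : dist f h ≤ r / 2) :
    IsKernel (coeff f) (nuDeriv h) (1 / sin (r / 2) ^ 4) (closeConst ξ r * dist f h ^ ξ) := by
  have hs : 0 < sin (r / 2) :=
    sin_pos_of_pos_of_lt_pi (by linarith [hr.1]) (by linarith [hr.2, pi_pos])
  have hfs := sin_half_le hr.1 hH.2 hfh
  have hhs : ∀ t, sin (r / 2) ≤ sin (h t) :=
    sin_half_le hr.1 hH.2 (by rw [dist_self]; linarith [hr.1])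
  refine ⟨measurable_coeff f.continuous.measurable, abs_coeff_le hf hs hfs, coeff_swap f,
    coeff_add_pi hf, fun α β hne => ?_, fun α => ?_⟩
  · have hfc := f.continuous
    unfold coeff
    refine ContinuousAt.div (by fun_prop) (by fun_prop) ?_
    have h1 := hs.trans_le (hfs α)
    have h2 := hs.trans_le (hfs β)
    have h3 : sin (β - α) ^ 2 ≠ 0 := pow_ne_zero _ hne
    positivity
  · obtain ⟨⟨d, hd, τ, hh⟩, hhull⟩ := hH
    have hint := (integrable_abs_sin_sub_rpow hξ α).const_mul
      (12 / sin (r / 2) ^ 8 * dist f h ^ ξ)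
    have h1 : ∀ᵐ β ∂period, ‖|coeff f α β - nuDeriv h α * nuDeriv h β|‖
        ≤ 12 / sin (r / 2) ^ 8 * dist f h ^ ξ * |sin (β - α)| ^ (-ξ) := by
      filter_upwards [ae_sin_sub_ne_zero α] with β hβ
      rw [Real.norm_eq_abs, abs_abs, nuDeriv, nuDeriv, infDist_circle hd hh,
        ← coeff_of_hemisphere hh hβ, mul_assoc]
      exact abs_coeff_sub_le_rpow hf hhull.1 hs hξ hfs hhs hβ
    have h2 := norm_integral_le_of_norm_le hint h1
    rw [integral_const_mul, integral_abs_sin_sub_rpow] at h2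
    refine (le_abs_self _).trans (h2.trans (le_of_eq ?_))
    unfold closeConst; ring

end CircleHull

namespace CircleHull

/-! ### The comass of the two-form -/

theorem period_eq_restrict_Ico : period = volume.restrict (Ico 0 π) :=
  Measure.restrict_congr_set Ico_ae_eq_Ioc.symm

/-- Triangle integrals do not see null sets. -/
theorem integral_triangle_congr {E : Type*} {u u' : ℝ → E} (h : u =ᵐ[period] u')
    (G : ℝ → ℝ → E → E → ℝ) :
    ∫ α in (0 : ℝ)..π, ∫ β in α..π, G α β (u α) (u β)
      = ∫ α in (0 : ℝ)..π, ∫ β in α..π, G α β (u' α) (u' β) := by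
  rw [intervalIntegral_eq_period, intervalIntegral_eq_period]
  have hmem : ∀ᵐ α ∂period, α ∈ Ioc 0 π := ae_restrict_mem measurableSet_Ioc
  refine integral_congr_ae ?_
  filter_upwards [h, hmem] with α hα hm
  rw [intervalIntegral.integral_of_le hm.2, intervalIntegral.integral_of_le hm.2, hα]
  refine integral_congr_ae ?_
  have h' : u =ᵐ[volume.restrict (Ioc α π)] u' :=
    ae_restrict_of_ae_restrict_of_subset (Ioc_subset_Ioc_left hm.1.le) h
  filter_upwards [h'] with β hβ
  rw [hβ]

theorem form_congr (f : ℝ → ℝ) {v w : LInf} {v' w' : ℝ → ℝ} (hv : v =ᵐ[period] v')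
    (hw : w =ᵐ[period] w') :
    form f v w = ∫ α in (0 : ℝ)..π, ∫ β in α..π, coeff f α β * (v' α * w' β - v' β * w' α) := by
  have h : (fun x => (v x, w x)) =ᵐ[period] fun x => (v' x, w' x) := by
    filter_upwards [hv, hw] with x h1 h2
    rw [h1, h2]
  exact integral_triangle_congr h
    (fun α β a b => coeff f α β * (a.1 * b.2 - b.1 * a.2))

theorem coeFn_comb (a b : ℝ) (v w : LInf) :
    (a • v + b • w : LInf) =ᵐ[period] fun x => a * v x + b * w x := by
  rw [period_eq_restrict_Ico]
  filter_upwards [Lp.coeFn_add (a • v) (b • w), Lp.coeFn_smul a v, Lp.coeFn_smul b w]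
    with x h1 h2 h3
  rw [h1, Pi.add_apply, h2, h3]
  rfl

theorem form_comb (f : ℝ → ℝ) (a b c d : ℝ) (v w : LInf) :
    form f (a • v + b • w) (c • v + d • w) = (a * d - b * c) * form f v w := by
  rw [form_congr f (coeFn_comb a b v w) (coeFn_comb c d v w), form,
    ← intervalIntegral.integral_const_mul]
  refine intervalIntegral.integral_congr fun α _ => ?_
  rw [← intervalIntegral.integral_const_mul]
  refine intervalIntegral.integral_congr fun β _ => ?_
  ring

theorem form_eq_zero_of_not_linearIndependent (f : ℝ → ℝ) {v w : LInf}
    (h : ¬LinearIndependent ℝ ![v, w]) : form f v w = 0 := by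
  rw [LinearIndependent.pair_iff] at h
  push Not at h
  obtain ⟨s, t, hst, hne⟩ := h
  by_cases hs : s = 0
  · have ht := hne hs
    have hw : w = 0 := by
      rw [hs, zero_smul, zero_add] at hst
      exact (smul_eq_zero.1 hst).resolve_left ht
    have := form_comb f 1 0 0 0 v v
    simpa [hw] using this
  · have hv : v = (-(t / s)) • w + (0 : ℝ) • w := by
      have h1 : s • v = -(t • w) := eq_neg_of_add_eq_zero_left hst
      rw [zero_smul, add_zero, neg_smul, div_eq_inv_mul, mul_smul, ← smul_neg, ← h1, smul_smul,
        inv_mul_cancel₀ hs, one_smul]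
    have := form_comb f (-(t / s)) 0 1 0 w w
    rw [← hv] at this
    simpa using this

/-- The Euclidean plane. -/
abbrev Plane : Type := EuclideanSpace ℝ (Fin 2)

/-- The linear parametrization of the span of `v` and `w`. -/
def planeMap {V : Type*} [NormedAddCommGroup V] [NormedSpace ℝ V] (v w : V) : Plane →ₗ[ℝ] V where
  toFun x := x 0 • v + x 1 • w
  map_add' x y := by simp only [PiLp.add_apply, add_smul]; abel
  map_smul' a x := by simp only [PiLp.smul_apply, smul_eq_mul, RingHom.id_apply, smul_add, mul_smul]

section Area

variable {V : Type*} [NormedAddCommGroup V] [NormedSpace ℝ V] {v w : V}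

theorem volume_ellipse (L : Plane ≃ₗ[ℝ] Plane) (c : Plane) :
    volume.real ((fun x => L x + c) '' Metric.closedBall (0 : Plane) 1)
      = |LinearMap.det (L : Plane →ₗ[ℝ] Plane)| * π := by
  have h1 : (fun x => L x + c) '' Metric.closedBall (0 : Plane) 1
      = (fun x => x + c) '' ((L : Plane →ₗ[ℝ] Plane) '' Metric.closedBall (0 : Plane) 1) := by
    rw [image_image]; rfl
  rw [h1, Set.image_add_right, measureReal_def, measure_preimage_add_right,
    Measure.addHaar_image_linearMap, EuclideanSpace.volume_closedBall_fin_two]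
  rw [ENNReal.toReal_mul, ENNReal.toReal_ofReal (abs_nonneg _)]
  simp [ENNReal.toReal_ofReal pi_pos.le]

theorem isBounded_planeBall (h : LinearIndependent ℝ ![v, w]) :
    ∃ R, planeBall v w ⊆ Metric.closedBall 0 R := by
  have hker : LinearMap.ker (planeMap v w) = ⊥ := by
    rw [LinearMap.ker_eq_bot']
    intro x hx
    obtain ⟨h0, h1⟩ := LinearIndependent.pair_iff.1 h (x 0) (x 1) hx
    ext i
    fin_cases i
    · exact h0
    · exact h1
  obtain ⟨K, -, hK⟩ := LinearMap.exists_antilipschitzWith (planeMap v w) hker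
  refine ⟨K, fun x hx => ?_⟩
  have h1 := hK.le_mul_dist x 0
  rw [map_zero, dist_zero_right, dist_zero_right] at h1
  rw [mem_closedBall_zero_iff]
  have h2 : ‖planeMap v w x‖ ≤ 1 := hx
  exact h1.trans (mul_le_of_le_one_right K.2 h2)

theorem bddAbove_areas (h : LinearIndependent ℝ ![v, w]) :
    BddAbove {a : ℝ | ∃ A, IsEllipse A ∧ A ⊆ planeBall v w ∧ a = volume.real A} := by
  obtain ⟨R, hR⟩ := isBounded_planeBall h
  refine ⟨volume.real (Metric.closedBall (0 : Plane) R), ?_⟩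
  rintro a ⟨A, -, hA, rfl⟩
  exact measureReal_mono (hA.trans hR) Metric.isBounded_closedBall.measure_lt_top.ne

theorem disc_area_mem {s : ℝ} (hs : 0 < s) (h : ∀ x : Plane, ‖x‖ ≤ 1 → ‖planeMap v w x‖ ≤ 1 / s) :
    s ^ 2 * π ∈ {a : ℝ | ∃ A, IsEllipse A ∧ A ⊆ planeBall v w ∧ a = volume.real A} := by
  set L : Plane ≃ₗ[ℝ] Plane := LinearEquiv.smulOfNeZero ℝ Plane s hs.ne' with hL
  refine ⟨(fun x => L x + 0) '' Metric.closedBall (0 : Plane) 1, ⟨L, 0, rfl⟩, ?_, ?_⟩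
  · rintro _ ⟨x, hx, rfl⟩
    change ‖planeMap v w (L x + 0)‖ ≤ 1
    rw [add_zero]
    have h1 : L x = s • x := rfl
    rw [h1, map_smul, norm_smul, Real.norm_eq_abs, abs_of_pos hs]
    have := mul_le_mul_of_nonneg_left (h x (mem_closedBall_zero_iff.1 hx)) hs.le
    rwa [mul_one_div_cancel hs.ne'] at this
  · rw [volume_ellipse]
    have h1 : (L : Plane →ₗ[ℝ] Plane) = s • LinearMap.id := rfl
    rw [h1, LinearMap.det_smul, LinearMap.det_id, finrank_euclideanSpace_fin, mul_one, abs_of_pos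
      (by positivity)]

theorem norm_planeMap_le_add (v w : V) (x : Plane) (hx : ‖x‖ ≤ 1) :
    ‖planeMap v w x‖ ≤ 1 / (1 / (‖v‖ + ‖w‖ + 1)) := by
  have h0 : ∀ i, |x i| ≤ 1 := fun i => (PiLp.norm_apply_le x i).trans hx
  have h1 : planeMap v w x = x 0 • v + x 1 • w := rfl
  rw [h1, one_div_one_div]
  refine (norm_add_le _ _).trans ?_
  rw [norm_smul, norm_smul]
  have h2 := mul_le_mul_of_nonneg_right (h0 0) (norm_nonneg v)
  have h3 := mul_le_mul_of_nonneg_right (h0 1) (norm_nonneg w)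
  rw [Real.norm_eq_abs, Real.norm_eq_abs]
  linarith

theorem sSup_areas_pos (h : LinearIndependent ℝ ![v, w]) :
    0 < sSup {a : ℝ | ∃ A, IsEllipse A ∧ A ⊆ planeBall v w ∧ a = volume.real A} :=
  lt_of_lt_of_le (by positivity : 0 < (1 / (‖v‖ + ‖w‖ + 1)) ^ 2 * π)
    (le_csSup (bddAbove_areas h) (disc_area_mem (by positivity) (norm_planeMap_le_add v w)))

theorem innerRiemannianArea_le_one (h : ∀ x : Plane, ‖x‖ ≤ 1 → ‖planeMap v w x‖ ≤ 1) :
    innerRiemannianArea v w ≤ 1 := by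
  unfold innerRiemannianArea
  split_ifs with hi
  · have h1 := le_csSup (bddAbove_areas hi) (disc_area_mem (s := 1) one_pos (by simpa using h))
    rw [one_pow, one_mul] at h1
    exact div_le_one_of_le₀ h1 (pi_pos.le.trans h1)
  · exact zero_le_one

end Area

theorem ae_abs_le_norm (u : LInf) : ∀ᵐ x ∂period, |u x| ≤ ‖u‖ := by
  rw [period_eq_restrict_Ico]
  have h1 := ae_le_eLpNormEssSup (f := u) (μ := volume.restrict (Ico (0 : ℝ) π))
  filter_upwards [h1] with x hx
  rw [Lp.norm_def, ← Real.norm_eq_abs, ← toReal_enorm]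
  refine ENNReal.toReal_mono (Lp.eLpNorm_ne_top u) ?_
  rwa [eLpNorm_exponent_top]

theorem norm_le_of_ae_abs_le {u : LInf} {C : ℝ} (hC : 0 ≤ C) (h : ∀ᵐ x ∂period, |u x| ≤ C) :
    ‖u‖ ≤ C := by
  rw [period_eq_restrict_Ico] at h
  rw [Lp.norm_def, eLpNorm_exponent_top]
  exact ENNReal.toReal_le_of_le_ofReal hC (eLpNormEssSup_le_of_ae_bound h)

/-- In `L^∞`, the unit disc lies in the unit ball of the plane spanned by `v, w` exactly if
`v ^ 2 + w ^ 2 ≤ 1` almost everywhere; here the forward direction. -/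
theorem ae_sq_add_sq_le {v w : LInf} (h : ∀ x : Plane, ‖x‖ ≤ 1 → ‖planeMap v w x‖ ≤ 1) :
    ∀ᵐ x ∂period, v x ^ 2 + w x ^ 2 ≤ 1 := by
  have h1 : ∀ q : ℝ × ℝ, ∀ᵐ x ∂period, q.1 * v x + q.2 * w x ≤ √(q.1 ^ 2 + q.2 ^ 2) := by
    rintro ⟨a, b⟩
    set s := √(a ^ 2 + b ^ 2) with hs
    have hn : ‖(!₂[a, b] : Plane)‖ = s := by
      rw [EuclideanSpace.norm_eq, Fin.sum_univ_two, hs]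
      simp
    have h2 : ‖planeMap v w !₂[a, b]‖ ≤ s := by
      rcases (Real.sqrt_nonneg (a ^ 2 + b ^ 2)).eq_or_lt with h0 | h0
      · have : (!₂[a, b] : Plane) = 0 := by rw [← norm_eq_zero, hn, hs, ← h0]
        rw [this, map_zero, norm_zero, hs, ← h0]
      · have h3 := h (s⁻¹ • !₂[a, b]) (by
          rw [norm_smul, hn, norm_inv, Real.norm_eq_abs, abs_of_pos h0, inv_mul_cancel₀ h0.ne'])
        rw [map_smul, norm_smul, norm_inv, Real.norm_eq_abs, abs_of_pos h0,
          inv_mul_le_iff₀ h0, mul_one] at h3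
        exact h3
    filter_upwards [ae_abs_le_norm (planeMap v w !₂[a, b]), coeFn_comb a b v w] with x h4 h5
    have h6 : planeMap v w !₂[a, b] = a • v + b • w := rfl
    rw [h6, h5] at h4
    rw [h6] at h2
    exact (le_abs_self _).trans (h4.trans h2)
  have h2 := ae_all_iff.2 fun n : ℕ => h1 (TopologicalSpace.denseSeq (ℝ × ℝ) n)
  filter_upwards [h2] with x hx
  have hclosed : IsClosed {q : ℝ × ℝ | q.1 * v x + q.2 * w x ≤ √(q.1 ^ 2 + q.2 ^ 2)} :=
    isClosed_le (by fun_prop) (by fun_prop)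
  have h3 : (v x, w x) ∈ {q : ℝ × ℝ | q.1 * v x + q.2 * w x ≤ √(q.1 ^ 2 + q.2 ^ 2)} :=
    (TopologicalSpace.denseRange_denseSeq (ℝ × ℝ)).induction_on (v x, w x) hclosed hx
  have h4 : v x * v x + w x * w x ≤ √(v x ^ 2 + w x ^ 2) := h3
  set g := v x ^ 2 + w x ^ 2 with hg
  have hg0 : 0 ≤ g := by positivity
  have h5 : g ≤ √g := by rw [hg] at *; linarith
  by_contra hlt
  push Not at hlt
  have h6 := Real.sq_sqrt hg0
  nlinarith [Real.sqrt_nonneg g]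

theorem norm_planeMap_le {v w : LInf} (h : ∀ᵐ x ∂period, v x ^ 2 + w x ^ 2 ≤ 1) (y : Plane)
    (hy : ‖y‖ ≤ 1) : ‖planeMap v w y‖ ≤ 1 := by
  refine norm_le_of_ae_abs_le zero_le_one ?_
  filter_upwards [h, coeFn_comb (y 0) (y 1) v w] with x h1 h2
  have h3 : planeMap v w y = y 0 • v + y 1 • w := rfl
  rw [h3, h2]
  have h4 : y 0 ^ 2 + y 1 ^ 2 ≤ 1 := by
    have := EuclideanSpace.norm_sq_eq y
    rw [Fin.sum_univ_two, Real.norm_eq_abs, Real.norm_eq_abs, sq_abs, sq_abs] at this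
    rw [← this]
    exact pow_le_one₀ (norm_nonneg _) hy
  refine abs_le_of_sq_le_sq ?_ zero_le_one
  nlinarith [sq_nonneg (y 0 * w x - y 1 * v x), sq_nonneg (y 0), sq_nonneg (y 1),
    mul_le_mul h4 h1 (by positivity) zero_le_one]

theorem abs_form_le_mul_area {f : ℝ → ℝ} {S : ℝ}
    (hub : ∀ v w : LInf, (∀ᵐ x ∂period, v x ^ 2 + w x ^ 2 ≤ 1) → |form f v w| ≤ S) (v w : LInf) :
    |form f v w| ≤ S * innerRiemannianArea v w := by
  by_cases hi : LinearIndependent ℝ ![v, w]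
  swap
  · rw [form_eq_zero_of_not_linearIndependent f hi, abs_zero, innerRiemannianArea, if_neg hi,
      mul_zero]
  have hpos := sSup_areas_pos hi
  rw [innerRiemannianArea, if_pos hi, ← mul_div_assoc, le_div_iff₀ hpos]
  by_cases h0 : form f v w = 0
  · have hS : 0 ≤ S := by
      have := hub 0 0 (by
        rw [period_eq_restrict_Ico]
        filter_upwards [Lp.coeFn_zero ℝ ∞ (volume.restrict (Ico (0 : ℝ) π))] with x hx
        rw [hx]; simp)
      exact (abs_nonneg _).trans this
    rw [h0, abs_zero, zero_mul]
    positivity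
  have hform : 0 < |form f v w| := abs_pos.2 h0
  rw [← le_div_iff₀' hform]
  refine csSup_le ⟨_, disc_area_mem (v := v) (w := w) (s := 1 / (‖v‖ + ‖w‖ + 1)) (by positivity)
    (norm_planeMap_le_add v w)⟩ ?_
  rintro a ⟨A, ⟨L, c, rfl⟩, hA, rfl⟩
  rw [volume_ellipse, le_div_iff₀' hform]
  -- the centre of the ellipse may be moved to the origin, as the unit ball is symmetric and convex
  have hL : ∀ x : Plane, ‖x‖ ≤ 1 → ‖planeMap v w (L x)‖ ≤ 1 := by
    intro x hx
    have h1 : ‖planeMap v w (L x + c)‖ ≤ 1 := hA ⟨x, mem_closedBall_zero_iff.2 hx, rfl⟩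
    have h2 : ‖planeMap v w (L (-x) + c)‖ ≤ 1 :=
      hA ⟨-x, mem_closedBall_zero_iff.2 (by rwa [norm_neg]), rfl⟩
    have h3 : (2 : ℝ) • planeMap v w (L x)
        = planeMap v w (L x + c) - planeMap v w (L (-x) + c) := by
      rw [← map_sub, ← map_smul]
      congr 1
      rw [map_neg, two_smul]; abel
    have h4 := norm_sub_le (planeMap v w (L x + c)) (planeMap v w (L (-x) + c))
    rw [← h3, norm_smul, Real.norm_eq_abs, abs_two] at h4
    linarith
  set p := L (EuclideanSpace.single 0 1) with hp
  set q := L (EuclideanSpace.single 1 1) with hq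
  have hcomp : ∀ x : Plane, planeMap (p 0 • v + p 1 • w) (q 0 • v + q 1 • w) x
      = planeMap v w (L x) := by
    intro x
    have h1 : x = x 0 • EuclideanSpace.single 0 1 + x 1 • EuclideanSpace.single 1 1 := by
      ext i; fin_cases i <;> simp
    have h2 : L x = x 0 • p + x 1 • q := by
      conv_lhs => rw [h1]
      rw [map_add, map_smul, map_smul]
    have h3 : ∀ i, L x i = x 0 * p i + x 1 * q i := fun i => by rw [h2]; simp
    change x 0 • (p 0 • v + p 1 • w) + x 1 • (q 0 • v + q 1 • w) = L x 0 • v + L x 1 • w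
    rw [h3, h3]
    module
  have hdet : LinearMap.det (L : Plane →ₗ[ℝ] Plane) = p 0 * q 1 - p 1 * q 0 := by
    rw [← LinearMap.det_toMatrix (EuclideanSpace.basisFun (Fin 2) ℝ).toBasis, Matrix.det_fin_two]
    simp [LinearMap.toMatrix_apply, hp, hq]
    ring
  have key := hub _ _ (ae_sq_add_sq_le (v := p 0 • v + p 1 • w) (w := q 0 • v + q 1 • w)
    fun x hx => by rw [hcomp]; exact hL x hx)
  rw [form_comb, abs_mul, ← hdet] at key
  nlinarith [pi_pos]

/-- The inner Riemannian comass is the maximum of the two-form on pairs with `v ^ 2 + w ^ 2 ≤ 1`. -/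
theorem comass_eq {f : ℝ → ℝ} {S : ℝ}
    (hub : ∀ v w : LInf, (∀ᵐ x ∂period, v x ^ 2 + w x ^ 2 ≤ 1) → |form f v w| ≤ S)
    {v₀ w₀ : LInf} (h₀ : ∀ᵐ x ∂period, v₀ x ^ 2 + w₀ x ^ 2 ≤ 1) (hS : form f v₀ w₀ = S) :
    comass f = S := by
  have hS0 : 0 ≤ S := (abs_nonneg _).trans (hub v₀ w₀ h₀)
  refine le_antisymm (csInf_le ⟨0, fun M hM => hM.1⟩ ⟨hS0, abs_form_le_mul_area hub⟩)
    (le_csInf ⟨S, hS0, abs_form_le_mul_area hub⟩ ?_)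
  rintro M ⟨hM0, hM⟩
  have h1 := hM v₀ w₀
  rw [hS, abs_of_nonneg hS0] at h1
  exact h1.trans (mul_le_of_le_one_right hM0 (innerRiemannianArea_le_one (norm_planeMap_le h₀)))

end CircleHull

namespace CircleHull

/-! ### The small ball in `L²₀` -/

theorem mem_smallBall_iff {e : ℝ} (he : 0 ≤ e) {η : ℝ →ₘ[volume] ℝ} :
    η ∈ smallBall e ↔ (∀ᵐ x : ℝ, η (x + π) = η x) ∧ (∀ᵐ x : ℝ, |η x| ≤ e) ∧
      ∫ x, η x ∂period = 0 := by
  unfold smallBall L2Zero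
  rw [← intervalIntegral_eq_period]
  constructor
  · rintro ⟨⟨h1, -, h3⟩, h4⟩
    refine ⟨h1, ?_, h3⟩
    rw [eLpNorm_exponent_top] at h4
    filter_upwards [ae_le_eLpNormEssSup (f := η) (μ := volume)] with x hx
    have := hx.trans h4
    rwa [← ofReal_norm, ENNReal.ofReal_le_ofReal_iff he] at this
  · rintro ⟨h1, h2, h3⟩
    refine ⟨⟨h1, fun K hK => ?_, h3⟩, ?_⟩
    · have : IsFiniteMeasure (volume.restrict K) := ⟨by
        rw [Measure.restrict_apply_univ]; exact hK.measure_lt_top⟩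
      exact MemLp.of_bound η.aestronglyMeasurable.restrict e (ae_restrict_of_ae h2)
    · rw [eLpNorm_exponent_top]
      exact eLpNormEssSup_le_of_ae_bound h2

theorem ae_eq_period {η : ℝ →ₘ[volume] ℝ} {g : ℝ → ℝ} (h : ∀ᵐ x : ℝ, η x = g x) :
    η =ᵐ[period] g :=
  ae_restrict_of_ae h

theorem coeFn_segment (a b : ℝ) (η₀ η₁ : ℝ →ₘ[volume] ℝ) :
    ∀ᵐ x : ℝ, (a • η₀ + b • η₁ : ℝ →ₘ[volume] ℝ) x = a * η₀ x + b * η₁ x := by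
  filter_upwards [AEEqFun.coeFn_add (a • η₀) (b • η₁), AEEqFun.coeFn_smul a η₀,
    AEEqFun.coeFn_smul b η₁] with x h1 h2 h3
  rw [h1, Pi.add_apply, h2, h3]
  rfl

/-- Elements of the small ball have representatives that are bounded everywhere. -/
theorem exists_bounded_rep {e : ℝ} (he : 0 ≤ e) {η : ℝ →ₘ[volume] ℝ} (h : η ∈ smallBall e) :
    ∃ g : ℝ → ℝ, Measurable g ∧ (∀ x, |g x| ≤ e) ∧ ∀ᵐ x : ℝ, η x = g x := by
  refine ⟨fun x => max (-e) (min e (η x)), ?_, fun x => ?_, ?_⟩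
  · exact measurable_const.max (measurable_const.min η.measurable)
  · exact abs_le.2 ⟨le_max_left _ _, max_le (by linarith) (min_le_left _ _)⟩
  · filter_upwards [((mem_smallBall_iff he).1 h).2.1] with x hx
    obtain ⟨h1, h2⟩ := abs_le.1 hx
    rw [min_eq_right h2, max_eq_right h1]

theorem ae_add_const {P : ℝ → Prop} (h : ∀ᵐ x : ℝ, P x) (c : ℝ) : ∀ᵐ x : ℝ, P (x + c) :=
  (measurePreserving_add_right volume c).quasiMeasurePreserving.ae h

theorem convex_smallBall {e : ℝ} (he : 0 ≤ e) : Convex ℝ (smallBall e) := by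
  intro x hx y hy a b ha hb hab
  obtain ⟨f, hfm, hfb, hf⟩ := exists_bounded_rep he hx
  obtain ⟨g, hgm, hgb, hg⟩ := exists_bounded_rep he hy
  obtain ⟨hx1, hx2, hx3⟩ := (mem_smallBall_iff he).1 hx
  obtain ⟨hy1, hy2, hy3⟩ := (mem_smallBall_iff he).1 hy
  have hc := coeFn_segment a b x y
  refine (mem_smallBall_iff he).2 ⟨?_, ?_, ?_⟩
  · filter_upwards [hc, ae_add_const hc π, hx1, hy1] with t h1 h2 h3 h4
    rw [h1, h2, h3, h4]
  · filter_upwards [hc, hx2, hy2] with t h1 h2 h3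
    rw [h1]
    refine (abs_add_le _ _).trans ?_
    rw [abs_mul, abs_mul, abs_of_nonneg ha, abs_of_nonneg hb]
    have h4 := mul_le_mul_of_nonneg_left h2 ha
    have h5 := mul_le_mul_of_nonneg_left h3 hb
    have h6 : a * e + b * e = e := by rw [← add_mul, hab, one_mul]
    linarith
  · have h1 : ∫ t, (a • x + b • y : ℝ →ₘ[volume] ℝ) t ∂period = ∫ t, (a * f t + b * g t) ∂period := by
      refine integral_congr_ae ?_
      filter_upwards [ae_eq_period hc, ae_eq_period hf, ae_eq_period hg] with t h1 h2 h3
      rw [h1, h2, h3]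
    have hfB : BddMeas f := ⟨hfm, e, hfb⟩
    have hgB : BddMeas g := ⟨hgm, e, hgb⟩
    rw [h1, integral_add (BddMeas.integrable (by fun_prop) _)
      (BddMeas.integrable (by fun_prop) _), integral_const_mul, integral_const_mul,
      ← integral_congr_ae (ae_eq_period hf), ← integral_congr_ae (ae_eq_period hg), hx3, hy3]
    ring

/-- An almost everywhere `π`-periodic function that vanishes on one period vanishes. -/
theorem ae_eq_zero_of_periodic {ζ : ℝ →ₘ[volume] ℝ} (hper : ∀ᵐ x : ℝ, ζ (x + π) = ζ x)
    (h0 : ∀ᵐ x ∂period, ζ x = 0) : ∀ᵐ x : ℝ, ζ x = 0 := by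
  have h1 : ∀ n : ℤ, ∀ᵐ x : ℝ, ζ (x + n • π) = ζ x := by
    intro n
    induction n using Int.induction_on with
    | zero => simp
    | succ k ih =>
      filter_upwards [ih, ae_add_const hper ((k : ℤ) • π)] with x h2 h3
      rw [← h2, ← h3, add_smul, one_smul, add_assoc]
    | pred k ih =>
      filter_upwards [ih, ae_add_const hper ((-(k : ℤ) - 1) • π)] with x h2 h3
      rw [← h3, ← h2, sub_smul, one_smul]
      congr 1; abel
  have h0' : ∀ᵐ x : ℝ, x ∈ Ioc 0 π → ζ x = 0 := (ae_restrict_iff' measurableSet_Ioc).1 h0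
  have h2 : ∀ᵐ x : ℝ, ∀ n : ℤ, ζ (x + n • π) = ζ x ∧ (x + n • π ∈ Ioc 0 π → ζ (x + n • π) = 0) :=
    ae_all_iff.2 fun n => (h1 n).and (ae_add_const h0' (n • π))
  filter_upwards [h2] with x hx
  obtain ⟨n, hn, -⟩ := existsUnique_add_zsmul_mem_Ioc pi_pos x 0
  rw [zero_add] at hn
  rw [← (hx n).1]
  exact (hx n).2 hn

theorem normSqL2_pos {e : ℝ} (he : 0 ≤ e) {x y : ℝ →ₘ[volume] ℝ} (hx : x ∈ smallBall e)
    (hy : y ∈ smallBall e) (hxy : x ≠ y) : 0 < normSqL2 (y - x) := by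
  obtain ⟨f, hfm, hfb, hf⟩ := exists_bounded_rep he hx
  obtain ⟨g, hgm, hgb, hg⟩ := exists_bounded_rep he hy
  have hfB : BddMeas f := ⟨hfm, e, hfb⟩
  have hgB : BddMeas g := ⟨hgm, e, hgb⟩
  have hc := AEEqFun.coeFn_sub y x
  have hfg : ∀ᵐ t : ℝ, (y - x) t = g t - f t := by
    filter_upwards [hc, hf, hg] with t h1 h2 h3
    rw [h1, Pi.sub_apply, h2, h3]
  rw [normSqL2, intervalIntegral_eq_period]
  have hint : Integrable (fun t => (y - x) t ^ 2) period := by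
    refine (BddMeas.integrable (f := fun t => (g t - f t) ^ 2) (by fun_prop) period).congr ?_
    filter_upwards [ae_eq_period hfg] with t ht
    rw [ht]
  refine mul_pos pi_pos (lt_of_le_of_ne (integral_nonneg fun t => sq_nonneg _) fun h0 => hxy ?_)
  have h1 := (integral_eq_zero_iff_of_nonneg (fun t => sq_nonneg _) hint).1 h0.symm
  have h2 : ∀ᵐ t ∂period, (y - x) t = 0 := by
    filter_upwards [h1] with t ht
    exact pow_eq_zero_iff two_ne_zero |>.1 ht
  have h3 : ∀ᵐ t : ℝ, (y - x) (t + π) = (y - x) t := by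
    filter_upwards [hc, ae_add_const hc π, ((mem_smallBall_iff he).1 hx).1,
      ((mem_smallBall_iff he).1 hy).1] with t h1 h2 h3 h4
    rw [h1, h2, Pi.sub_apply, Pi.sub_apply, h3, h4]
  have h4 := ae_eq_zero_of_periodic h3 h2
  have h5 : y - x = 0 := AEEqFun.ext (by
    filter_upwards [h4, AEEqFun.coeFn_zero (α := ℝ) (β := ℝ) (μ := volume)] with t h5 h6
    rw [h5, h6]; rfl)
  exact (sub_eq_zero.1 h5).symm

/-! ### The functional and the two-form as integrals over the square -/

variable {h f : ℝ →ᵇ ℝ} {ρ : ℝ → ℝ} {m M θ e : ℝ}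

theorem Psi_eq (hp : IsKernel (coeff f) ρ M θ) (ha : IsAngle (nu h) ρ m M)
    {η : ℝ →ₘ[volume] ℝ} {g : ℝ → ℝ} (hg : Measurable g) (hη : η =ᵐ[period] g) :
    Psi h f η = (∫ z, orient z.1 z.2 * coeff f z.1 z.2
      * sin (nu h z.2 - nu h z.1 + (g z.2 - g z.1)) ∂period2) / 2 := by
  have hb := hp.bddMeas
  have hn := ha.nu_continuous.measurable
  unfold Psi
  rw [integral_triangle_congr hη
    (fun α β a b => coeff f α β * sin ((nu h β - nu h α) + (b - a)))]
  refine integral_triangle (F := fun z => orient z.1 z.2 * coeff f z.1 z.2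
      * sin (nu h z.2 - nu h z.1 + (g z.2 - g z.1))) (by fun_prop) (fun α β => ?_) (fun α => ?_)
    fun α β h1 h2 h3 => ?_
  · simp only
    rw [orient_swap, hp.symm, show nu h α - nu h β + (g α - g β)
      = -(nu h β - nu h α + (g β - g α)) by ring, sin_neg]
    ring
  · simp [orient_self]
  · simp only
    rw [orient_of_lt h2 (by linarith), one_mul]

theorem form_eq (hp : IsKernel (coeff f) ρ M θ) {v w : LInf} {v' w' : ℝ → ℝ}
    (hv' : BddMeas v') (hw' : BddMeas w') (hv : v =ᵐ[period] v') (hw : w =ᵐ[period] w') :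
    form f v w = (∫ z, orient z.1 z.2 * coeff f z.1 z.2
      * (v' z.1 * w' z.2 - v' z.2 * w' z.1) ∂period2) / 2 := by
  have hb := hp.bddMeas
  rw [form_congr f hv hw]
  refine integral_triangle (F := fun z => orient z.1 z.2 * coeff f z.1 z.2
      * (v' z.1 * w' z.2 - v' z.2 * w' z.1)) (by fun_prop) (fun α β => ?_) (fun α => ?_)
    fun α β h1 h2 h3 => ?_
  · simp only
    rw [orient_swap, hp.symm]
    ring
  · simp [orient_self]
  · simp only
    rw [orient_of_lt h2 (by linarith), one_mul]

/-- Along segments in the small ball the functional is smooth with second derivative bounded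
above by a negative multiple of the squared norm. -/
theorem Psi_segment (hp : IsKernel (coeff f) ρ M θ) (ha : IsAngle (nu h) ρ m M) (he : 0 ≤ e)
    {c : ℝ} (hc : 2 * π * c ≤ (4 - π) * m - 4 * (θ + 2 * π * e * M))
    {η₀ η₁ : ℝ →ₘ[volume] ℝ} (h₀ : η₀ ∈ smallBall e) (h₁ : η₁ ∈ smallBall e) :
    ContDiff ℝ 2 (fun t : ℝ => Psi h f ((1 - t) • η₀ + t • η₁)) ∧
      ∀ t ∈ Set.Icc (0 : ℝ) 1,
        iteratedDeriv 2 (fun s : ℝ => Psi h f ((1 - s) • η₀ + s • η₁)) t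
          ≤ -c * normSqL2 (η₁ - η₀) := by
  obtain ⟨f₀, hm₀, hb₀, hf₀⟩ := exists_bounded_rep he h₀
  obtain ⟨f₁, hm₁, hb₁, hf₁⟩ := exists_bounded_rep he h₁
  have hB₀ : BddMeas f₀ := ⟨hm₀, e, hb₀⟩
  have hB₁ : BddMeas f₁ := ⟨hm₁, e, hb₁⟩
  have hb := hp.bddMeas
  have hn := ha.nu_continuous.measurable
  set ζ : ℝ → ℝ := fun x => f₁ x - f₀ x with hζ
  have hζm : BddMeas ζ := by fun_prop
  set P : ℝ × ℝ → ℝ := fun z => orient z.1 z.2 * coeff f z.1 z.2 / 2 with hP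
  set A : ℝ × ℝ → ℝ := fun z => nu h z.2 - nu h z.1 + (f₀ z.2 - f₀ z.1) with hA
  set B : ℝ × ℝ → ℝ := fun z => ζ z.2 - ζ z.1 with hB
  have hPm : BddMeas P := by fun_prop
  have hAm : Measurable A := by fun_prop
  have hBm : BddMeas B := by fun_prop
  have harg : ∀ (t : ℝ) (z : ℝ × ℝ), nu h z.2 - nu h z.1
      + (((1 - t) * f₀ z.2 + t * f₁ z.2) - ((1 - t) * f₀ z.1 + t * f₁ z.1))
      = A z + t * B z := by
    intro t z; simp only [hA, hB, hζ]; ring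
  have hPsi : (fun t : ℝ => Psi h f ((1 - t) • η₀ + t • η₁))
      = fun t => ∫ z, P z * sin (A z + t * B z) ∂period2 := by
    funext t
    rw [Psi_eq hp ha (g := fun x => (1 - t) * f₀ x + t * f₁ x) (by fun_prop) ?_, ← integral_div]
    · refine integral_congr_ae (ae_of_all _ fun z => ?_)
      simp only
      rw [harg, hP]; ring
    · filter_upwards [ae_eq_period (coeFn_segment (1 - t) t η₀ η₁), ae_eq_period hf₀,
        ae_eq_period hf₁] with x a1 a2 a3
      rw [a1, a2, a3]
  rw [hPsi]
  refine ⟨contDiff_integral_sin period2 hBm 2 hPm hAm, fun t ht => ?_⟩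
  rw [iteratedDeriv_two_integral_sin period2 hPm hAm hBm]
  have hζ0 : ∫ x, ζ x ∂period = 0 := by
    simp only [hζ]
    rw [integral_sub (hB₁.integrable _) (hB₀.integrable _),
      ← integral_congr_ae (ae_eq_period hf₀), ← integral_congr_ae (ae_eq_period hf₁),
      ((mem_smallBall_iff he).1 h₀).2.2, ((mem_smallBall_iff he).1 h₁).2.2, sub_zero]
  have hbd : ∀ x, |(1 - t) * f₀ x + t * f₁ x| ≤ e := by
    intro x
    refine (abs_add_le _ _).trans ?_
    rw [abs_mul, abs_mul, abs_of_nonneg ht.1, abs_of_nonneg (by linarith [ht.2] : 0 ≤ 1 - t)]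
    have a1 := mul_le_mul_of_nonneg_left (hb₀ x) (by linarith [ht.2] : 0 ≤ 1 - t)
    have a2 := mul_le_mul_of_nonneg_left (hb₁ x) ht.1
    linarith
  have key := hp.coercive ha hbd (by fun_prop) hζm hζ0
  simp only [harg] at key
  have hnorm : normSqL2 (η₁ - η₀) = π * ∫ x, ζ x ^ 2 ∂period := by
    rw [normSqL2, intervalIntegral_eq_period]
    congr 1
    refine integral_congr_ae ?_
    filter_upwards [ae_eq_period (AEEqFun.coeFn_sub η₁ η₀), ae_eq_period hf₀,
        ae_eq_period hf₁] with x a1 a2 a3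
    rw [a1, Pi.sub_apply, a2, a3]
  have hint : ∫ z, P z * sin (A z + t * B z) * B z ^ 2 ∂period2
      = (∫ z, orient z.1 z.2 * coeff f z.1 z.2 * sin (A z + t * B z) * (ζ z.2 - ζ z.1) ^ 2
          ∂period2) / 2 := by
    rw [← integral_div]
    refine integral_congr_ae (ae_of_all _ fun z => ?_)
    simp only [hP, hB]
    ring
  rw [hnorm, hint]
  have h0 : 0 ≤ ∫ x, ζ x ^ 2 ∂period := integral_nonneg fun x => sq_nonneg _
  have := mul_le_mul_of_nonneg_right hc h0
  linarith

theorem strictConcaveOn_Psi (hp : IsKernel (coeff f) ρ M θ) (ha : IsAngle (nu h) ρ m M)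
    (he : 0 ≤ e) {c : ℝ} (hc0 : 0 < c)
    (hc : 2 * π * c ≤ (4 - π) * m - 4 * (θ + 2 * π * e * M)) :
    StrictConcaveOn ℝ (smallBall e) (Psi h f) := by
  refine ⟨convex_smallBall he, fun x hx y hy hxy a b ha0 hb0 hab => ?_⟩
  obtain ⟨h1, h2⟩ := Psi_segment hp ha he hc hx hy
  have hpos := normSqL2_pos he hx hy hxy
  set g := fun t : ℝ => Psi h f ((1 - t) • x + t • y) with hg
  have hconc : StrictConcaveOn ℝ (Icc (0 : ℝ) 1) g := by
    refine strictConcaveOn_of_deriv2_neg (convex_Icc 0 1) h1.continuous.continuousOn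
      fun t ht => ?_
    rw [interior_Icc] at ht
    rw [← iteratedDeriv_eq_iterate]
    refine (h2 t (Ioo_subset_Icc_self ht)).trans_lt ?_
    rw [neg_mul]
    exact neg_lt_zero.2 (mul_pos hc0 hpos)
  have h3 := hconc.2 (left_mem_Icc.2 zero_le_one) (right_mem_Icc.2 zero_le_one) zero_ne_one
    ha0 hb0 hab
  have e0 : g 0 = Psi h f x := by simp [hg]
  have e1 : g 1 = Psi h f y := by simp [hg]
  have e2 : g (a • 0 + b • 1) = Psi h f (a • x + b • y) := by
    simp only [hg, smul_eq_mul, mul_zero, zero_add, mul_one]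
    rw [show 1 - b = a by linarith]
  rwa [e0, e1, e2] at h3

/-- A small critical point maximizes the functional globally and computes the comass. -/
theorem maximal_of_gradient_eq_zero (hp : IsKernel (coeff f) ρ M θ) (ha : IsAngle (nu h) ρ m M)
    {g : ℝ → ℝ} (hg : ∀ x, |g x| ≤ e) (hgm : Measurable g)
    (hcrit : ∀ α, gradient (coeff f) (nu h) g α = 0)
    (hsmall : 2 * (θ + 2 * π * e * M) ≤ (4 - π) * m)
    {η₀ : ℝ →ₘ[volume] ℝ} (h₀ : η₀ =ᵐ[period] g) :
    (∀ η : ℝ →ₘ[volume] ℝ, Psi h f η ≤ Psi h f η₀) ∧ Psi h f η₀ = comass f := by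
  have hn := ha.nu_continuous.measurable
  have hmax : ∀ v w : ℝ → ℝ, Measurable v → Measurable w → (∀ x, v x ^ 2 + w x ^ 2 ≤ 1) →
      (∫ z, orient z.1 z.2 * coeff f z.1 z.2 * (v z.1 * w z.2 - v z.2 * w z.1) ∂period2) / 2
        ≤ Psi h f η₀ := by
    intro v w hv hw hvw
    rw [Psi_eq hp ha hgm h₀]
    linarith [hp.form_le_of_critical ha hg hgm hcrit hsmall hv hw hvw]
  have hsin : ∀ (u : ℝ → ℝ) (z : ℝ × ℝ),
      cos (nu h z.1 + u z.1) * sin (nu h z.2 + u z.2)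
        - cos (nu h z.2 + u z.2) * sin (nu h z.1 + u z.1)
      = sin (nu h z.2 - nu h z.1 + (u z.2 - u z.1)) := by
    intro u z
    rw [show nu h z.2 - nu h z.1 + (u z.2 - u z.1)
      = (nu h z.2 + u z.2) - (nu h z.1 + u z.1) by ring, sin_sub]
    ring
  refine ⟨fun η => ?_, ?_⟩
  · have hηm := η.measurable
    have := hmax (fun x => cos (nu h x + η x)) (fun x => sin (nu h x + η x)) (by fun_prop)
      (by fun_prop) (fun x => (cos_sq_add_sin_sq _).le)
    simp only [hsin] at this
    rwa [Psi_eq hp ha hηm (Filter.EventuallyEq.refl _ _)]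
  · have hub : ∀ v w : LInf, (∀ᵐ x ∂period, v x ^ 2 + w x ^ 2 ≤ 1) →
        form f v w ≤ Psi h f η₀ := by
      intro v w hvw
      have hvm : Measurable v := (Lp.stronglyMeasurable v).measurable
      have hwm : Measurable w := (Lp.stronglyMeasurable w).measurable
      set D : Set ℝ := {x | v x ^ 2 + w x ^ 2 ≤ 1} with hD
      have hDm : MeasurableSet D := measurableSet_le (by fun_prop) measurable_const
      have hsq : ∀ x, D.indicator v x ^ 2 + D.indicator w x ^ 2 ≤ 1 := by
        intro x
        by_cases hx : x ∈ D
        · rw [indicator_of_mem hx, indicator_of_mem hx]; exact hx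
        · rw [indicator_of_notMem hx, indicator_of_notMem hx]; norm_num
      have hv' : BddMeas (D.indicator v) := ⟨hvm.indicator hDm, 1, fun x =>
        abs_le_of_sq_le_sq (by nlinarith [hsq x, sq_nonneg (D.indicator w x)]) zero_le_one⟩
      have hw' : BddMeas (D.indicator w) := ⟨hwm.indicator hDm, 1, fun x =>
        abs_le_of_sq_le_sq (by nlinarith [hsq x, sq_nonneg (D.indicator v x)]) zero_le_one⟩
      rw [form_eq hp hv' hw' ?_ ?_]
      · exact hmax _ _ hv'.measurable hw'.measurable hsq
      · filter_upwards [hvw] with x hx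
        exact (indicator_of_mem (show x ∈ D from hx) _).symm
      · filter_upwards [hvw] with x hx
        exact (indicator_of_mem (show x ∈ D from hx) _).symm
    have hswap : ∀ v w : LInf, form f w v = -form f v w := by
      intro v w
      have := form_comb f 0 1 1 0 v w
      simpa using this
    have hLp : ∀ u : ℝ → ℝ, BddMeas u → ∃ v : LInf, v =ᵐ[period] u := by
      intro u hu
      obtain ⟨C, hC⟩ := hu.bounded
      have hmem : MemLp u ∞ (volume.restrict (Ico (0 : ℝ) π)) :=
        MemLp.of_bound hu.measurable.aestronglyMeasurable C (ae_of_all _ hC)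
      refine ⟨hmem.toLp u, ?_⟩
      rw [period_eq_restrict_Ico]
      exact hmem.coeFn_toLp
    obtain ⟨v₀, hv₀⟩ := hLp (fun x => cos (nu h x + g x)) (by fun_prop)
    obtain ⟨w₀, hw₀⟩ := hLp (fun x => sin (nu h x + g x)) (by fun_prop)
    refine (comass_eq (v₀ := v₀) (w₀ := w₀) (fun v w hvw => abs_le.2 ⟨?_, hub v w hvw⟩) ?_ ?_).symm
    · have := hub w v (by filter_upwards [hvw] with x hx; linarith)
      rw [hswap] at this
      linarith
    · filter_upwards [hv₀, hw₀] with x h1 h2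
      rw [h1, h2]
      exact (cos_sq_add_sin_sq _).le
    · rw [form_eq hp (by fun_prop) (by fun_prop) hv₀ hw₀, Psi_eq hp ha hgm h₀]
      simp only [hsin]

theorem IsAngle.mono {ν : ℝ → ℝ} {M' : ℝ} (ha : IsAngle ν ρ m M) (hM : M ≤ M') :
    IsAngle ν ρ m M' :=
  ⟨ha.pos, ha.hasDerivAt, ha.continuous, ha.lower, fun t => (ha.upper t).trans hM, ha.add_pi,
    ha.periodic⟩

/-- Existence of a small critical point in the small ball. -/
theorem exists_critical (hp : IsKernel (coeff f) ρ M θ) (ha : IsAngle (nu h) ρ m M) (he : 0 < e)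
    (h1 : 2 * π * e * M + 2 * θ ≤ m / 5) (h2 : θ ≤ m * e / 10) :
    ∃ g : ℝ → ℝ, Measurable g ∧ (∀ x, |g x| ≤ e) ∧ (∀ x, |g x| ≤ 10 * θ / m) ∧
      (∀ α, gradient (coeff f) (nu h) g α = 0) ∧
      ∃ η₀ ∈ smallBall e, ∀ᵐ x : ℝ, η₀ x = g x := by
  obtain ⟨η, hper, hb1, hb2, hcrit⟩ := hp.exists_gradient_eq_zero ha (R := e / 2) (by linarith)
    (by linarith) (by linarith)
  set k := (∫ x, η x ∂period) / π with hk
  have hkle : ∀ {c : ℝ}, (∀ x, |η x| ≤ c) → |k| ≤ c := by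
    intro c hc
    have := norm_integral_le_of_norm_le (μ := period) (f := η) (g := fun _ => c)
      (integrable_const c) (ae_of_all _ hc)
    rw [integral_period_const, Real.norm_eq_abs] at this
    rw [hk, abs_div, abs_of_pos pi_pos, div_le_iff₀ pi_pos]
    linarith
  have hm := η.continuous.measurable
  have hdiff : ∀ {c : ℝ}, (∀ x, |η x| ≤ c) → ∀ x, |η x - k| ≤ 2 * c := fun hc x =>
    (abs_sub _ _).trans (by linarith [hc x, hkle hc])
  have hgm : Measurable fun x => η x - k := hm.sub_const k
  have hcoe : ∀ᵐ x : ℝ, (AEEqFun.mk (fun x => η x - k) hgm.aestronglyMeasurable :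
      ℝ →ₘ[volume] ℝ) x = η x - k := AEEqFun.coeFn_mk _ _
  refine ⟨fun x => η x - k, hgm, fun x => (hdiff hb2 x).trans (by linarith),
    fun x => (hdiff hb1 x).trans (le_of_eq (by ring)), fun α => ?_,
    AEEqFun.mk (fun x => η x - k) hgm.aestronglyMeasurable,
    (mem_smallBall_iff he.le).2 ⟨?_, ?_, ?_⟩, hcoe⟩
  · rw [← hcrit α]
    simp only [gradient, sub_sub_sub_cancel_right]
  · filter_upwards [hcoe, ae_add_const hcoe π] with x a1 a2
    rw [a1, a2, hper]
  · filter_upwards [hcoe] with x a1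
    rw [a1]
    exact (hdiff hb2 x).trans (by linarith)
  · rw [integral_congr_ae (ae_eq_period hcoe), integral_sub ?_ (integrable_const _),
      integral_period_const, hk]
    · field_simp
      ring
    · exact BddMeas.integrable ⟨hm, _, hb1⟩ _

theorem closeConst_nonneg {ξ r : ℝ} : 0 ≤ closeConst ξ r := by
  unfold closeConst
  have : 0 ≤ ∫ β, |sin β| ^ (-ξ) ∂period := integral_nonneg fun β => by positivity
  positivity

end CircleHull

end

/-! ### Choice of the constants -/

theorem proposition4 (ξ : ℝ) (hξ : ξ ∈ Set.Ioo (0 : ℝ) 1) (r : ℝ)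
    (hr : r ∈ Set.Ioo (0 : ℝ) (Real.pi / 2)) :
    ∃ ε₁ ε₂ c C : ℝ, ε₁ ∈ Set.Ioo (0 : ℝ) (r / 2) ∧ 0 < ε₂ ∧ 0 < c ∧ 0 < C ∧
      ∀ h ∈ CircleHull.hemisphere ∩ CircleHull.truncatedHull r,
      ∀ f ∈ Metric.closedBall h ε₁ ∩ CircleHull.hullPos,
        StrictConcaveOn ℝ (CircleHull.smallBall ε₂) (CircleHull.Psi h f) ∧
        (∀ η₀ ∈ CircleHull.smallBall ε₂, ∀ η₁ ∈ CircleHull.smallBall ε₂,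
          ContDiff ℝ 2 (fun t : ℝ => CircleHull.Psi h f ((1 - t) • η₀ + t • η₁)) ∧
          ∀ t ∈ Set.Icc (0 : ℝ) 1,
            iteratedDeriv 2 (fun s : ℝ => CircleHull.Psi h f ((1 - s) • η₀ + s • η₁)) t
              ≤ -c * CircleHull.normSqL2 (η₁ - η₀)) ∧
        ∃ η_f ∈ CircleHull.smallBall ε₂,
          IsMaxOn (CircleHull.Psi h f) (CircleHull.smallBall ε₂) η_f ∧
          (∀ η ∈ CircleHull.smallBall ε₂,
            IsMaxOn (CircleHull.Psi h f) (CircleHull.smallBall ε₂) η → η = η_f) ∧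
          IsLUB (CircleHull.Psi h f '' CircleHull.L2Zero) (CircleHull.Psi h f η_f) ∧
          CircleHull.Psi h f η_f = CircleHull.comass f ∧
          eLpNorm η_f ∞ volume ≤ ENNReal.ofReal (C * dist f h ^ ξ) := by
  open CircleHull in
  have hpi := pi_pos
  set s := sin (r / 2) with hs_def
  have hs : 0 < s := sin_pos_of_pos_of_lt_pi (by linarith [hr.1]) (by linarith [hr.2])
  have hs1 : s ≤ 1 := sin_le_one _
  set M := 1 / s ^ 4 with hM_def
  have hM : 0 < M := by positivity
  have hM1 : 1 ≤ M := by
    rw [hM_def, le_div_iff₀ (by positivity), one_mul]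
    exact pow_le_one₀ hs.le hs1
  set m := sin r with hm_def
  have hm : 0 < m := sin_pos_of_pos_of_lt_pi hr.1 (by linarith [hr.2])
  have hm1 : m ≤ 1 := sin_le_one _
  have hsm : s ≤ m := sin_le_sin_of_le_of_le_pi_div_two (by linarith [hr.1]) hr.2.le
    (by linarith [hr.1])
  have hMm : 1 / m ^ 2 ≤ M := by
    refine one_div_le_one_div_of_le (by positivity) ?_
    calc s ^ 4 ≤ s ^ 2 := pow_le_pow_of_le_one hs.le hs1 (by norm_num)
      _ ≤ m ^ 2 := pow_le_pow_left₀ hs.le hsm 2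
  -- `e` is chosen such that the errors of order `π * e * M` are small compared to `m`
  set e := m / (100 * π * M) with he_def
  have he : 0 < e := by positivity
  have heM : π * e * M = m / 100 := by
    rw [he_def]; field_simp
  have he1 : e ≤ 1 / 100 := by
    have h1 : π * e * 1 ≤ m / 100 := by
      rw [← heM]; exact mul_le_mul_of_nonneg_left hM1 (by positivity)
    nlinarith [pi_gt_three]
  set C₁ := closeConst ξ r with hC₁_def
  have hC₁ : 0 ≤ C₁ := closeConst_nonneg
  set δ := (m * e / (10 * (C₁ + 1))) ^ (1 / ξ) with hδ_def
  have hbase : 0 < m * e / (10 * (C₁ + 1)) := by positivity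
  have hδ : 0 < δ := rpow_pos_of_pos hbase _
  refine ⟨min (r / 4) δ, e, m / 10, 10 * C₁ / m + 1,
    ⟨lt_min (by linarith [hr.1]) hδ, (min_le_left _ _).trans_lt (by linarith [hr.1])⟩, he,
    by positivity, by positivity, ?_⟩
  rintro h hh f ⟨hfh, hf⟩
  rw [Metric.mem_closedBall] at hfh
  have hd0 : 0 ≤ dist f h := dist_nonneg
  have hp := isKernel_coeff hξ hr hh hf.1
    (hfh.trans ((min_le_left _ _).trans (by linarith [hr.1])))
  have ha := (isAngle_nu hr hh).mono hMm
  rw [← hs_def, ← hM_def, ← hC₁_def] at hp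
  set θ := C₁ * dist f h ^ ξ with hθ_def
  have hθ0 : 0 ≤ θ := by positivity
  have hθ : θ ≤ m * e / 10 := by
    have h1 : dist f h ^ ξ ≤ m * e / (10 * (C₁ + 1)) := by
      refine (rpow_le_rpow hd0 (hfh.trans (min_le_right _ _)) hξ.1.le).trans (le_of_eq ?_)
      rw [hδ_def, ← rpow_mul hbase.le, one_div_mul_cancel hξ.1.ne', rpow_one]
    calc θ ≤ (C₁ + 1) * (m * e / (10 * (C₁ + 1))) :=
          mul_le_mul (by linarith) h1 (by positivity) (by linarith)
      _ = m * e / 10 := by field_simp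
  have hθm : θ ≤ m / 1000 := by nlinarith
  have hπm : π * m ≤ 3.15 * m := mul_le_mul_of_nonneg_right pi_lt_d2.le hm.le
  have hc : 2 * π * (m / 10) ≤ (4 - π) * m - 4 * (θ + 2 * π * e * M) := by linarith
  have hsmall : 2 * (θ + 2 * π * e * M) ≤ (4 - π) * m := by linarith
  have hconc := strictConcaveOn_Psi hp ha he.le (by positivity : 0 < m / 10) hc
  refine ⟨hconc, fun η₀ h₀ η₁ h₁ => Psi_segment hp ha he.le hc h₀ h₁, ?_⟩
  obtain ⟨g, hgm, hge, hgθ, hcrit, η_f, hη_f, hcoe⟩ := exists_critical hp ha he (by linarith) hθ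
  obtain ⟨hmax, hcomass⟩ := maximal_of_gradient_eq_zero hp ha hge hgm hcrit hsmall
    (ae_eq_period hcoe)
  have hmaxOn : IsMaxOn (Psi h f) (smallBall e) η_f := fun η _ => hmax η
  refine ⟨η_f, hη_f, hmaxOn, fun η hη hηmax => hconc.eq_of_isMaxOn hηmax hmaxOn hη hη_f,
    ⟨?_, fun b hb => hb ⟨η_f, hη_f.1, rfl⟩⟩, hcomass, ?_⟩
  · rintro _ ⟨η, -, rfl⟩
    exact hmax η
  · rw [eLpNorm_exponent_top]
    refine eLpNormEssSup_le_of_ae_bound ?_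
    filter_upwards [hcoe] with x hx
    rw [Real.norm_eq_abs, hx]
    refine (hgθ x).trans ?_
    have h1 : 0 ≤ dist f h ^ ξ := by positivity
    rw [hθ_def, add_mul, one_mul, show 10 * (C₁ * dist f h ^ ξ) / m
      = 10 * C₁ / m * dist f h ^ ξ by ring]
    linarith
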